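/- Let $F$ be an algebraically closed field of characteristic $p$, where $p$ is a prime or $p=\infty$ (the latter meaning characteristic zero). Let $n\ge 4$ and let $\mathbb{I}_n$ be the dihedral group of order $2n$, viewed as a Coxeter group with simple reflections $S=\{s_1,s_2\}$, where $s_1s_2$ has order $n$, and length function $\ell$. For $J\subseteq S$ put $$x_J=\sum_{w\in X_J}w\in F\mathbb{I}_n,\qquad X_J=\{w\in\mathbb{I}_n:\ \ell(ws)>\ell(w)\text{ for all }s\in J\},$$ and let $\mathscr{D}_F(\mathbb{I}_n)$ be the descent algebra, the subalgebra of the group algebra $F\mathbb{I}_n$ generated by the elements $x_J$ ($J\subseteq S$). It is equal to the $F$-span of these four elements and has dimension $4$. Then $\mathscr{D}_F(\mathbb{I}_n)$ is tame if $p=2$ and $n$ is even, and it has finite representation type otherwise. Here a finite-dimensional $F$-algebra $A$ has finite representation type if, up to isomorphism, it has only finitely many indecomposable finite-dimensional left modules. It is tame if it does not have finite representation type but, for each integer $d\ge 1$, there are finitely many $A$-$F[T]$-bimodules $M_1,\dots,M_k$ (with $F$ acting centrally), each finitely generated and free over $F[T]$, such that all but finitely many isomorphism classes of indecomposable $A$-modules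 of dimension $d$ over $F$ contain a module $M_i\otimes_{F[T]}F[T]/(T-c)$ with $1\le i\le k$ and $c\in F$. -/

import Mathlib

open scoped TensorProduct Polynomial

universe u v w

/-! ### Descent algebras of finite Coxeter systems -/

section Descent

variable {B : Type w} {M : CoxeterMatrix B} {W : Type v} [Group W]

/-- The distinguished (minimal length) left coset representatives `X_J` of the standard parabolic
subgroup `W_J`: the elements `w` with `ℓ(ws) > ℓ(w)` for all `s ∈ J`. Subsets of the set of simple
reflections are given by sets `J` of indices. -/
def CoxeterSystem.minCosetReps (cs : CoxeterSystem M W) (J : Set B) : Set W :=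
  {x | ∀ i ∈ J, cs.length x < cs.length (x * cs.simple i)}

open Classical in
/-- The element `x_J = ∑_{w ∈ X_J} w` of the group algebra `FW`. -/
noncomputable def CoxeterSystem.descentElement (F : Type u) [Field F] [Fintype W]
    (cs : CoxeterSystem M W) (J : Set B) : MonoidAlgebra F W :=
  ∑ x : W with x ∈ cs.minCosetReps J, MonoidAlgebra.of F W x

/-- The (Solomon) descent algebra of a finite Coxeter system over `F`: the subalgebra of the group
algebra `FW` generated by the elements `x_J`. By Solomon's theorem it is the `F`-span of
the `x_J`. -/
noncomputable def CoxeterSystem.descentAlgebra (F : Type u) [Field F] [Fintype W]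
    (cs : CoxeterSystem M W) : Subalgebra F (MonoidAlgebra F W) :=
  Algebra.adjoin F (Set.range (cs.descentElement F))

end Descent

/-! ### Representation type of a finite-dimensional algebra

Modules are left modules. Isomorphism classes of finite-dimensional modules are represented by
modules in the universe of the ground field `F`; this is no restriction, since every
finite-dimensional module is isomorphic to one with underlying space `F^d`. -/

/-- A module is indecomposable if it is nonzero and is not an internal direct sum of two nonzero
submodules. -/
def IsIndecomposableModule (A : Type v) [Ring A] (M : Type w) [AddCommGroup M] [Module A M] :
    Prop :=
  Nontrivial M ∧ ∀ P Q : Submodule A M, IsCompl P Q → P = ⊥ ∨ Q = ⊥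

section RepType

variable (F : Type u) [Field F] (A : Type v) [Ring A] [Algebra F A]

/-- `A` has finite representation type: up to isomorphism there are only finitely many
indecomposable `A`-modules that are finite-dimensional over `F`. -/
def HasFiniteRepType : Prop :=
  ∃ S : Set (ModuleCat.{u} A), S.Finite ∧
    ∀ N : ModuleCat.{u} A, Module.Finite F (RestrictScalars F A N) →
      IsIndecomposableModule A N → ∃ N' ∈ S, Nonempty (N ≃ₗ[A] N')

/-- A one-parameter family of `A`-modules: an `A`-`F[T]`-bimodule (on which `F` acts centrally)
that is finitely generated and free over `F[T]`. As `F[T]` is commutative, its action is written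
on the left. -/
structure OneParameterFamily where
  /-- the underlying bimodule -/
  carrier : Type u
  [addCommGroup : AddCommGroup carrier]
  [moduleAlg : Module A carrier]
  [modulePoly : Module F[X] carrier]
  [smulComm : SMulCommClass F[X] A carrier]
  central : ∀ (c : F) (m : carrier), algebraMap F A c • m = (Polynomial.C c : F[X]) • m
  [free : Module.Free F[X] carrier]
  [finite : Module.Finite F[X] carrier]

attribute [instance] OneParameterFamily.addCommGroup OneParameterFamily.moduleAlg
  OneParameterFamily.modulePoly OneParameterFamily.smulComm OneParameterFamily.free
  OneParameterFamily.finite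

variable {F A} in
/-- The member `𝓜 ⊗_{F[T]} F[T]/(T - c)` of a one-parameter family at the parameter `c ∈ F`. -/
abbrev OneParameterFamily.fiber (𝓜 : OneParameterFamily F A) (c : F) : Type u :=
  𝓜.carrier ⊗[F[X]] (F[X] ⧸ Ideal.span {(Polynomial.X - Polynomial.C c : F[X])})

/-- `A` has tame representation type: it is not of finite representation type, but for each
dimension `d ≥ 1` there are finitely many one-parameter families such that, up to isomorphism, all
except finitely many indecomposable `A`-modules of dimension `d` belong to these families. -/
def HasTameRepType : Prop :=
  ¬ HasFiniteRepType F A ∧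
  ∀ d : ℕ, 0 < d →
    ∃ (S : Set (ModuleCat.{u} A)) (T : Set (OneParameterFamily F A)), S.Finite ∧ T.Finite ∧
      ∀ N : ModuleCat.{u} A, Module.finrank F (RestrictScalars F A N) = d →
        IsIndecomposableModule A N →
        (∃ N' ∈ S, Nonempty (N ≃ₗ[A] N')) ∨
          ∃ 𝓜 ∈ T, ∃ c : F, Nonempty (N ≃ₗ[A] 𝓜.fiber c)

end RepType

/-!
The descent algebra of the dihedral group of order `2 n` has the basis `1, a, b, z`, where `a` and
`b` are the sums of the two sets of coset representatives `X_i` and `z = x_∅` is the sum of all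
group elements. The elements of `X_i` are the `n` alternating words of length less than `n` that
end in the other reflection `j`. Two words that differ by a reflection `i` on the left contribute
`x_i (1 + i) = z` to a product with `x_i` on the left, so products are computed by pairing the
words: for `n = 2 h` one gets `a² = 2 a + (h - 1) z`, `b² = 2 b + (h - 1) z` and
`a b = b a = h z`, for `n = 2 h + 1` one gets `a² = b a = a + h z` and `b² = a b = b + h z`. In all
cases `a z = z a = b z = z b = n z` and `z² = 2 n z`.

Finite type. After a change of generators the algebra has an idempotent `e` and one of three simple
tables: two orthogonal idempotents and an element `z` annihilated by both with `z² = c z`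
(`n` even, `2 ≠ 0`), or a map `y` from the kernel of `e` to its image together with an element `z`
supported on one of these two spaces, with products `y z` or `z y` equal to zero (`n` odd). In an
indecomposable module, a vector where some generator or product does not vanish, its images, and
suitably chosen functionals with invertible pairing matrix span a direct summand
(`IsIndecomposableModule.hasMatrices_of_frame`), so that the module is that summand; finitely many
tuples of matrices remain.

Tame type. If `2 = 0` in `F` and `n` is even, then the algebra is local and symmetric with radical
cube zero (`IsLocalSymmetric`). A vector not killed by the socle generates a free direct summand,
so an indecomposable module other than the algebra itself is a module over
`F[x, y] / (x, y)²`. Such a module is the same as a pencil of linear maps `α, β : V → W`, which is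
again indecomposable. If `α` is
not surjective, the indecomposable pencil `(α, β)` is recovered from its derived pencil, the
restriction of both maps to `β⁻¹ (α V)`; by induction it is determined up to equivalence by the
dimensions of `V` and `W` (`LinearPencil.IsIndecomposable.equivalent_of_not_surjective`). Duality
deals with the case where `α` is not injective. If `α` is bijective, then, `F` being algebraically
closed, some `β - c α` is not surjective, and hence `(α, β)` is one of the pencils
`(α, γ + c α)` for a fixed pencil `(α, γ)`: these form a one-parameter family. The
two-dimensional modules on which `x ≠ 0` and `y = c x` show that there are infinitely many
indecomposable modules.
-/

/-! ### Pencils of linear maps -/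

/-- The kernel of a functional is complementary to any line on which the functional is nonzero. -/
theorem isCompl_ker_span_singleton {F V : Type*} [Field F] [AddCommGroup V] [Module F V]
    {φ : V →ₗ[F] F} {v : V} (h : φ v ≠ 0) : IsCompl (LinearMap.ker φ) (Submodule.span F {v}) := by
  constructor
  · rw [Submodule.disjoint_def]
    intro x hx hxv
    obtain ⟨c, rfl⟩ := Submodule.mem_span_singleton.1 hxv
    have : c * φ v = 0 := by simpa using hx
    rcases mul_eq_zero.1 this with h0 | h0
    · simp [h0]
    · exact absurd h0 h
  · rw [codisjoint_iff, eq_top_iff]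
    intro x _
    refine Submodule.mem_sup.2 ⟨x - (φ x / φ v) • v, ?_, (φ x / φ v) • v,
      Submodule.smul_mem _ _ (Submodule.mem_span_singleton_self v), by simp⟩
    simp [h]

theorem Submodule.isCompl_prod {F V W : Type*} [Field F] [AddCommGroup V] [Module F V]
    [AddCommGroup W] [Module F W] {P Q : Submodule F V} {P' Q' : Submodule F W}
    (h : IsCompl P Q) (h' : IsCompl P' Q') : IsCompl (P.prod P') (Q.prod Q') := by
  constructor
  · rw [disjoint_iff, Submodule.prod_inf_prod, h.inf_eq_bot, h'.inf_eq_bot, Submodule.prod_bot]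
  · rw [codisjoint_iff, Submodule.prod_sup_prod, h.sup_eq_top, h'.sup_eq_top, Submodule.prod_top]

theorem isCompl_comap_equiv {F V W : Type*} [Field F] [AddCommGroup V] [Module F V]
    [AddCommGroup W] [Module F W] (e : V ≃ₗ[F] W) {P Q : Submodule F W} (h : IsCompl P Q) :
    IsCompl (P.comap (e : V →ₗ[F] W)) (Q.comap (e : V →ₗ[F] W)) :=
  (Submodule.orderIsoMapComap e).symm.isCompl h

theorem eq_bot_of_comap_equiv {F V W : Type*} [Field F] [AddCommGroup V] [Module F V]
    [AddCommGroup W] [Module F W] (e : V ≃ₗ[F] W) {P : Submodule F W}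
    (h : P.comap (e : V →ₗ[F] W) = ⊥) : P = ⊥ :=
  (Submodule.orderIsoMapComap e).symm.injective (h.trans (by simp :
    (⊥ : Submodule F V) = (⊥ : Submodule F W).comap (e : V →ₗ[F] W)))

namespace LinearPencil

section Basic

variable {F : Type*} [Field F] {V W V' W' : Type*} [AddCommGroup V] [Module F V]
  [AddCommGroup W] [Module F W] [AddCommGroup V'] [Module F V'] [AddCommGroup W'] [Module F W']

/-- A pencil, that is, a pair of linear maps `α, β : V → W`, is indecomposable if it is nonzero and
is not the direct sum of two nonzero pencils. -/
def IsIndecomposable (α β : V →ₗ[F] W) : Prop :=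
  (Nontrivial V ∨ Nontrivial W) ∧
    ∀ (P Q : Submodule F V) (P' Q' : Submodule F W), IsCompl P Q → IsCompl P' Q' →
      P ≤ P'.comap α → P ≤ P'.comap β → Q ≤ Q'.comap α → Q ≤ Q'.comap β →
      (P = ⊥ ∧ P' = ⊥) ∨ (Q = ⊥ ∧ Q' = ⊥)

/-- Isomorphism (strict equivalence) of pencils. -/
def Equivalent (α β : V →ₗ[F] W) (α' β' : V' →ₗ[F] W') : Prop :=
  ∃ (g : V ≃ₗ[F] V') (h : W ≃ₗ[F] W'), (∀ v, h (α v) = α' (g v)) ∧ ∀ v, h (β v) = β' (g v)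

theorem Equivalent.symm {α β : V →ₗ[F] W} {α' β' : V' →ₗ[F] W'} (h : Equivalent α β α' β') :
    Equivalent α' β' α β := by
  obtain ⟨g, h, h1, h2⟩ := h
  refine ⟨g.symm, h.symm, fun v => ?_, fun v => ?_⟩
  · rw [LinearEquiv.symm_apply_eq, h1, LinearEquiv.apply_symm_apply]
  · rw [LinearEquiv.symm_apply_eq, h2, LinearEquiv.apply_symm_apply]

theorem Equivalent.trans {V'' W'' : Type*} [AddCommGroup V''] [Module F V'']
    [AddCommGroup W''] [Module F W''] {α β : V →ₗ[F] W} {α' β' : V' →ₗ[F] W'}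
    {α'' β'' : V'' →ₗ[F] W''} (h : Equivalent α β α' β') (h' : Equivalent α' β' α'' β'') :
    Equivalent α β α'' β'' := by
  obtain ⟨g, h, h1, h2⟩ := h
  obtain ⟨g', h', h1', h2'⟩ := h'
  exact ⟨g.trans g', h.trans h', fun v => by simp [h1, h1'], fun v => by simp [h2, h2']⟩

theorem IsIndecomposable.of_equivalent {α β : V →ₗ[F] W} {α' β' : V' →ₗ[F] W'}
    (hi : IsIndecomposable α β) (h : Equivalent α β α' β') : IsIndecomposable α' β' := by
  obtain ⟨g, h, h1, h2⟩ := h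
  refine ⟨hi.1.imp (fun (_ : Nontrivial V) => g.injective.nontrivial)
    (fun (_ : Nontrivial W) => h.injective.nontrivial), ?_⟩
  intro P Q P' Q' c c' pa pb qa qb
  have key : ∀ (R : Submodule F V') (R' : Submodule F W') (γ : V →ₗ[F] W) (γ' : V' →ₗ[F] W'),
      (∀ v, h (γ v) = γ' (g v)) → R ≤ R'.comap γ' →
      R.comap (g : V →ₗ[F] V') ≤ (R'.comap (h : W →ₗ[F] W')).comap γ := by
    intro R R' γ γ' hγ hR v hv
    simp only [Submodule.mem_comap, LinearEquiv.coe_coe] at hv ⊢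
    rw [hγ]
    exact hR hv
  exact (hi.2 (P.comap (g : V →ₗ[F] V')) (Q.comap (g : V →ₗ[F] V'))
      (P'.comap (h : W →ₗ[F] W')) (Q'.comap (h : W →ₗ[F] W'))
      (isCompl_comap_equiv g c) (isCompl_comap_equiv h c')
      (key _ _ _ _ h1 pa) (key _ _ _ _ h2 pb) (key _ _ _ _ h1 qa) (key _ _ _ _ h2 qb)).imp
    (fun a => ⟨eq_bot_of_comap_equiv g a.1, eq_bot_of_comap_equiv h a.2⟩)
    (fun a => ⟨eq_bot_of_comap_equiv g a.1, eq_bot_of_comap_equiv h a.2⟩)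

/-- Replacing `(α, β)` by `(β - c α, α)` does not change the decompositions of a pencil. -/
theorem IsIndecomposable.sub_smul {α β : V →ₗ[F] W} (hi : IsIndecomposable α β) (c : F) :
    IsIndecomposable (β - c • α) α := by
  refine ⟨hi.1, fun P Q P' Q' h h' pa pb qa qb => hi.2 P Q P' Q' h h' pb ?_ qb ?_⟩
  · intro v hv
    have h1 : β v - c • α v ∈ P' := pa hv
    simpa using P'.add_mem h1 (P'.smul_mem c (pb hv))
  · intro v hv
    have h1 : β v - c • α v ∈ Q' := qa hv
    simpa using Q'.add_mem h1 (Q'.smul_mem c (qb hv))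

end Basic

section Exceptional

variable {F : Type*} [Field F] {V W V' W' : Type*} [AddCommGroup V] [Module F V]
  [AddCommGroup W] [Module F W] [AddCommGroup V'] [Module F V'] [AddCommGroup W'] [Module F W']

open Module

/-- The images of the two maps of an indecomposable pencil span the target, unless the pencil is
the one with source `0` and target a line. -/
theorem IsIndecomposable.range_sup_range {α β : V →ₗ[F] W} (hi : IsIndecomposable α β) :
    LinearMap.range α ⊔ LinearMap.range β = ⊤ ∨ (finrank F V = 0 ∧ finrank F W = 1) := by
  by_contra! hcon
  obtain ⟨h1, h2⟩ := hcon
  obtain ⟨w, -, hw⟩ := SetLike.exists_of_lt (lt_top_iff_ne_top.2 h1)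
  obtain ⟨φ, hφ, hle⟩ := Submodule.exists_le_ker_of_notMem hw
  have hc := isCompl_ker_span_singleton hφ
  have hw0 : w ≠ 0 := fun h => hφ (by simp [h])
  rcases hi.2 ⊤ ⊥ _ _ isCompl_top_bot hc
    (fun v _ => hle (Submodule.mem_sup_left ⟨v, rfl⟩))
    (fun v _ => hle (Submodule.mem_sup_right ⟨v, rfl⟩)) (by simp) (by simp) with ⟨a, b⟩ | ⟨-, b⟩
  · refine h2 ?_ ?_
    · rw [← finrank_top F V, a, finrank_bot]
    · have : Submodule.span F {w} = ⊤ := by simpa [b] using hc.sup_eq_top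
      rw [← finrank_top F W, ← this, finrank_span_singleton hw0]
  · exact hw0 (Submodule.span_singleton_eq_bot.1 b)

/-- If `α x = 0` but `β x` is not in the image of `α`, then `x` and `β x` span a direct summand. -/
theorem IsIndecomposable.ker_le_comap {α β : V →ₗ[F] W} (hi : IsIndecomposable α β) :
    LinearMap.ker α ≤ (LinearMap.range α).comap β ∨ (finrank F V = 1 ∧ finrank F W = 1) := by
  by_contra! hcon
  obtain ⟨h1, h2⟩ := hcon
  obtain ⟨x, hx, hxβ⟩ := SetLike.not_le_iff_exists.1 h1
  rw [Submodule.mem_comap] at hxβ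
  obtain ⟨φ, hφ, hle⟩ := Submodule.exists_le_ker_of_notMem hxβ
  have hc := isCompl_ker_span_singleton hφ
  have hc' : IsCompl (LinearMap.ker (φ ∘ₗ β)) (Submodule.span F {x}) :=
    isCompl_ker_span_singleton (by simpa using hφ)
  have hw0 : β x ≠ 0 := fun h => hφ (by simp [h])
  have hx0 : x ≠ 0 := fun h => hw0 (by simp [h])
  have hx' : α x = 0 := hx
  rcases hi.2 _ _ _ _ hc' hc
    (fun v _ => hle ⟨v, rfl⟩) (fun v hv => hv)
    (by rw [Submodule.span_singleton_le_iff_mem, Submodule.mem_comap, hx']; exact zero_mem _)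
    (by rw [Submodule.span_singleton_le_iff_mem]; exact Submodule.mem_span_singleton_self _)
    with ⟨a, b⟩ | ⟨-, b⟩
  · refine h2 ?_ ?_
    · have : Submodule.span F {x} = ⊤ := by simpa [a] using hc'.sup_eq_top
      rw [← finrank_top F V, ← this, finrank_span_singleton hx0]
    · have : Submodule.span F {β x} = ⊤ := by simpa [b] using hc.sup_eq_top
      rw [← finrank_top F W, ← this, finrank_span_singleton hw0]
  · exact hw0 (Submodule.span_singleton_eq_bot.1 b)

theorem eq_zero_of_not_surjective [FiniteDimensional F W] {α : V →ₗ[F] W}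
    (hs : ¬ Function.Surjective α) (hW : finrank F W = 1) : α = 0 := by
  rw [← LinearMap.range_eq_bot, ← Submodule.finrank_eq_zero (R := F)]
  have := Submodule.finrank_lt (mt LinearMap.range_eq_top.1 hs)
  lia

theorem IsIndecomposable.bijective_right [FiniteDimensional F V] [FiniteDimensional F W]
    {β : V →ₗ[F] W} (hi : IsIndecomposable 0 β) (hV : finrank F V = 1) (hW : finrank F W = 1) :
    Function.Bijective β := by
  have hsurj : Function.Surjective β := by
    rcases hi.range_sup_range with h | h
    · rw [← LinearMap.range_eq_top]; simpa using h
    · lia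
  exact ⟨(LinearMap.injective_iff_surjective_of_finrank_eq_finrank (hV.trans hW.symm)).2 hsurj,
    hsurj⟩

/-- Two indecomposable pencils with the same source dimension, target a line, and first map zero
are isomorphic. -/
theorem equivalent_of_finrank_eq_one [FiniteDimensional F V] [FiniteDimensional F W]
    [FiniteDimensional F V'] [FiniteDimensional F W']
    {α β : V →ₗ[F] W} {α' β' : V' →ₗ[F] W'}
    (hi : IsIndecomposable α β) (hi' : IsIndecomposable α' β') (hs : ¬ Function.Surjective α)
    (hs' : ¬ Function.Surjective α') (hV : finrank F V' = finrank F V)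
    (hW : finrank F W = 1) (hW' : finrank F W' = 1) (hV1 : finrank F V ≤ 1) :
    Equivalent α β α' β' := by
  obtain rfl := eq_zero_of_not_surjective hs hW
  obtain rfl := eq_zero_of_not_surjective hs' hW'
  rcases Nat.le_one_iff_eq_zero_or_eq_one.1 hV1 with h0 | h1
  · have := finrank_zero_iff.1 h0
    have := finrank_zero_iff.1 (hV.trans h0)
    refine ⟨LinearEquiv.ofFinrankEq _ _ hV.symm, LinearEquiv.ofFinrankEq _ _ (hW.trans hW'.symm),
      by simp, fun v => ?_⟩
    rw [Subsingleton.elim v 0]; simp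
  · let e := LinearEquiv.ofBijective β (hi.bijective_right h1 hW)
    let e' := LinearEquiv.ofBijective β'
      (hi'.bijective_right (hV.trans h1) hW')
    let h := LinearEquiv.ofFinrankEq W W' (hW.trans hW'.symm)
    refine ⟨(e.trans h).trans e'.symm, h, by simp, fun v => ?_⟩
    have : e' (((e.trans h).trans e'.symm) v) = h (e v) := by simp
    exact this.symm

end Exceptional

end LinearPencil

/-! ### Extensions and derived pencils -/

namespace LinearPencil

section Extension

variable {F : Type*} [Field F] {V W V' W' C : Type*} [AddCommGroup V] [Module F V]
  [AddCommGroup W] [Module F W] [AddCommGroup V'] [Module F V'] [AddCommGroup W'] [Module F W']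
  [AddCommGroup C] [Module F C]

/-- Given a pencil `(α, β)` from `V` to `W` and a map `ι : C → W`, the first map
`(v, c) ↦ (α v + ι c, 0)` of the extended pencil from `V × C` to `W × C`. -/
def extFst (α : V →ₗ[F] W) (ι : C →ₗ[F] W) : V × C →ₗ[F] W × C := (α.coprod ι).prod 0

/-- The second map `(v, c) ↦ (β v, c)` of the extended pencil from `V × C` to `W × C`. -/
def extSnd (C : Type*) [AddCommGroup C] [Module F C] (β : V →ₗ[F] W) : V × C →ₗ[F] W × C :=
  β.prodMap LinearMap.id

@[simp] theorem extFst_apply (α : V →ₗ[F] W) (ι : C →ₗ[F] W) (x : V × C) :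
    extFst α ι x = (α x.1 + ι x.2, 0) := rfl

@[simp] theorem extSnd_apply (β : V →ₗ[F] W) (x : V × C) :
    extSnd C β x = (β x.1, x.2) := rfl

theorem Equivalent.ext {α β : V →ₗ[F] W} {α' β' : V' →ₗ[F] W'} {ι : C →ₗ[F] W} {g : V ≃ₗ[F] V'}
    {h : W ≃ₗ[F] W'} (hα : ∀ v, h (α v) = α' (g v)) (hβ : ∀ v, h (β v) = β' (g v)) :
    Equivalent (extFst α ι) (extSnd C β) (extFst α' (h ∘ₗ ι)) (extSnd C β') :=
  ⟨g.prodCongr (LinearEquiv.refl F C), h.prodCongr (LinearEquiv.refl F C),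
    fun v => by simp [hα], fun v => by simp [hβ]⟩

theorem exists_disjoint_sup_eq_of_le {P Q : Submodule F W} (h : P ≤ Q) :
    ∃ R, Disjoint P R ∧ P ⊔ R = Q := by
  obtain ⟨E, hE⟩ := P.exists_isCompl
  refine ⟨E ⊓ Q, hE.disjoint.mono_right inf_le_left, ?_⟩
  rw [← sup_inf_assoc_of_le E h, hE.sup_eq_top, top_inf_eq]

/-- If `(α, β)` decomposes then so does its extension along a suitable complement of the image of
`α`. -/
theorem isIndecomposable_of_ext {α β : V →ₗ[F] W}
    (hne : Nontrivial V ∨ Nontrivial W)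
    (H : ∀ (C D : Submodule F W), IsCompl (LinearMap.range α)
      (LinearMap.range (C.subtype.coprod D.subtype)) →
      Function.Injective (C.subtype.coprod D.subtype) →
      IsIndecomposable (extFst α (C.subtype.coprod D.subtype)) (extSnd (C × D) β)) :
    IsIndecomposable α β := by
  refine ⟨hne, fun P Q P' Q' c c' pa pb qa qb => ?_⟩
  obtain ⟨R, hR, hR'⟩ := exists_disjoint_sup_eq_of_le (Submodule.map_le_iff_le_comap.2 pa)
  obtain ⟨S, hS, hS'⟩ := exists_disjoint_sup_eq_of_le (Submodule.map_le_iff_le_comap.2 qa)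
  have hRP : R ≤ P' := hR' ▸ le_sup_right
  have hSQ : S ≤ Q' := hS' ▸ le_sup_right
  have hrange : LinearMap.range α = P.map α ⊔ Q.map α := by
    rw [← Submodule.map_sup, c.sup_eq_top, Submodule.map_top]
  have hrange' : LinearMap.range (R.subtype.coprod S.subtype) = R ⊔ S := by
    rw [LinearMap.range_coprod, Submodule.range_subtype, Submodule.range_subtype]
  have hcompl : IsCompl (LinearMap.range α) (LinearMap.range (R.subtype.coprod S.subtype)) := by
    rw [hrange, hrange']
    constructor
    · rw [Submodule.disjoint_def]
      intro x hx hx'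
      obtain ⟨p, hp, q, hq, rfl⟩ := Submodule.mem_sup.1 hx
      obtain ⟨r, hr, s, hs, h⟩ := Submodule.mem_sup.1 hx'
      have hp' : p ∈ P' := hR' ▸ Submodule.mem_sup_left hp
      have hq' : q ∈ Q' := hS' ▸ Submodule.mem_sup_left hq
      have e : r - p = q - s := by
        rw [sub_eq_sub_iff_add_eq_add, h, add_comm]
      have e1 : r - p = 0 := Submodule.disjoint_def.1 c'.disjoint _ (P'.sub_mem (hRP hr) hp')
        (e ▸ Q'.sub_mem hq' (hSQ hs))
      have e2 : q - s = 0 := e ▸ e1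
      have p0 : p = 0 := Submodule.disjoint_def.1 hR p hp (sub_eq_zero.1 e1 ▸ hr)
      have q0 : q = 0 := Submodule.disjoint_def.1 hS q hq ((sub_eq_zero.1 e2).symm ▸ hs)
      rw [p0, q0, add_zero]
    · rw [codisjoint_iff, sup_sup_sup_comm, hR', hS', c'.sup_eq_top]
  have hinj : Function.Injective (R.subtype.coprod S.subtype) := by
    rw [← LinearMap.ker_eq_bot, LinearMap.ker_eq_bot']
    rintro ⟨r, s⟩ h
    have h' : (r : W) + s = 0 := by simpa using h
    have hr : (r : W) = 0 := Submodule.disjoint_def.1 c'.disjoint _ (hRP r.2)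
      (by rw [eq_neg_of_add_eq_zero_left h']; exact Q'.neg_mem (hSQ s.2))
    have hs : (s : W) = 0 := by simpa [hr] using h'
    ext <;> simp [hr, hs]
  have hi := H R S hcompl hinj
  have d : IsCompl ((⊤ : Submodule F R).prod (⊥ : Submodule F S))
      ((⊥ : Submodule F R).prod (⊤ : Submodule F S)) :=
    Submodule.isCompl_prod isCompl_top_bot isCompl_bot_top
  refine (hi.2 _ _ _ _ (Submodule.isCompl_prod c d) (Submodule.isCompl_prod c' d) ?_ ?_ ?_ ?_).imp
    (fun h => ⟨((Submodule.prod_eq_bot_iff _ _ _).1 h.1).1,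
      ((Submodule.prod_eq_bot_iff _ _ _).1 h.2).1⟩)
    (fun h => ⟨((Submodule.prod_eq_bot_iff _ _ _).1 h.1).1,
      ((Submodule.prod_eq_bot_iff _ _ _).1 h.2).1⟩)
  all_goals
    rintro ⟨v, r, s⟩ hx
    simp only [Submodule.mem_prod, Submodule.mem_comap, Submodule.mem_top, Submodule.mem_bot,
      extFst_apply, extSnd_apply, LinearMap.coprod_apply, Submodule.subtype_apply, true_and,
      and_true, Prod.fst_zero, Prod.snd_zero] at hx ⊢
  · exact P'.add_mem (pa hx.1) (by simpa [hx.2] using hRP r.2)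
  · exact ⟨pb hx.1, hx.2⟩
  · exact Q'.add_mem (qa hx.1) (by simpa [hx.2] using hSQ s.2)
  · exact ⟨qb hx.1, hx.2⟩

end Extension

section Derived

variable {F : Type*} [Field F] {V W V' W' C : Type*} [AddCommGroup V] [Module F V]
  [AddCommGroup W] [Module F W] [AddCommGroup V'] [Module F V'] [AddCommGroup W'] [Module F W']
  [AddCommGroup C] [Module F C]

/-- The source `β⁻¹(im α)` of the derived pencil of `(α, β)`; its target is the image of `α`. -/
abbrev derivedSource (α β : V →ₗ[F] W) : Submodule F V := (LinearMap.range α).comap β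

/-- The first map of the derived pencil, the restriction of `α`. -/
def derivedFst (α β : V →ₗ[F] W) : derivedSource α β →ₗ[F] LinearMap.range α :=
  α.restrict fun v _ => ⟨v, rfl⟩

/-- The second map of the derived pencil, the restriction of `β`. -/
def derivedSnd (α β : V →ₗ[F] W) : derivedSource α β →ₗ[F] LinearMap.range α :=
  β.restrict fun _ hv => hv

@[simp] theorem derivedFst_coe (α β : V →ₗ[F] W) (v : derivedSource α β) :
    (derivedFst α β v : W) = α v := rfl

@[simp] theorem derivedSnd_coe (α β : V →ₗ[F] W) (v : derivedSource α β) :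
    (derivedSnd α β v : W) = β v := rfl

/-- A pencil with no exceptional summand is recovered from its derived pencil: it is the extension
of the latter along any complement of the image of its first map. -/
theorem equivalent_ext_derived {α β : V →ₗ[F] W}
    (h1 : LinearMap.range α ⊔ LinearMap.range β = ⊤) (h2 : LinearMap.ker α ≤ derivedSource α β)
    {ι : C →ₗ[F] LinearMap.range α} (hι : Function.Injective ι)
    (hc : IsCompl (LinearMap.range (derivedFst α β)) (LinearMap.range ι)) :
    Equivalent (extFst (derivedFst α β) ι) (extSnd C (derivedSnd α β)) α β := by
  obtain ⟨σ, hσ⟩ := α.rangeRestrict.exists_rightInverse_of_surjective α.range_rangeRestrict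
  have hσ' : ∀ w : LinearMap.range α, α (σ w) = w := fun w =>
    congrArg Subtype.val (LinearMap.congr_fun hσ w)
  -- the chosen lift of `C` to `V` is a complement of the source of the derived pencil
  have hmem : ∀ c, σ (ι c) ∈ derivedSource α β → c = 0 := by
    intro c hcm
    refine hι ?_
    rw [map_zero]
    refine Submodule.disjoint_def.1 hc.disjoint _ ⟨⟨_, hcm⟩, ?_⟩ ⟨c, rfl⟩
    exact Subtype.ext (hσ' _)
  have hspan : ∀ v, ∃ x : derivedSource α β × C, (x.1 : V) + σ (ι x.2) = v := by
    intro v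
    have : (⟨α v, v, rfl⟩ : LinearMap.range α) ∈
      LinearMap.range (derivedFst α β) ⊔ LinearMap.range ι := by rw [hc.sup_eq_top]; trivial
    obtain ⟨_, ⟨x, rfl⟩, _, ⟨c, rfl⟩, h⟩ := Submodule.mem_sup.1 this
    have h' : α x + ι c = α v := congrArg Subtype.val h
    refine ⟨⟨x + ⟨v - x - σ (ι c), h2 ?_⟩, c⟩, ?_⟩
    · show (x : V) + (v - x - σ (ι c)) + σ (ι c) = v
      abel
    rw [LinearMap.mem_ker, map_sub, map_sub, hσ', ← h']
    abel
  let g : derivedSource α β × C →ₗ[F] V := (derivedSource α β).subtype.coprod (σ ∘ₗ ι)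
  let h : LinearMap.range α × C →ₗ[F] W := (LinearMap.range α).subtype.coprod (β ∘ₗ σ ∘ₗ ι)
  have hg : Function.Bijective g := by
    constructor
    · rw [← LinearMap.ker_eq_bot, LinearMap.ker_eq_bot']
      rintro ⟨x, c⟩ hx
      have hx' : (x : V) + σ (ι c) = 0 := by simpa [g] using hx
      have c0 : c = 0 := hmem c (by
        rw [eq_neg_of_add_eq_zero_right hx']; exact Submodule.neg_mem _ x.2)
      subst c0
      have x0 : x = 0 := Subtype.ext (by simpa using hx')
      rw [x0]; rfl
    · intro v
      obtain ⟨x, hx⟩ := hspan v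
      exact ⟨x, hx⟩
  have hh : Function.Bijective h := by
    constructor
    · rw [← LinearMap.ker_eq_bot, LinearMap.ker_eq_bot']
      rintro ⟨x, c⟩ hx
      have hx' : (x : W) + β (σ (ι c)) = 0 := by simpa [h] using hx
      have c0 : c = 0 := hmem c (by
        rw [Submodule.mem_comap, eq_neg_of_add_eq_zero_right hx']
        exact Submodule.neg_mem _ x.2)
      subst c0
      have x0 : x = 0 := Subtype.ext (by simpa using hx')
      rw [x0]; rfl
    · intro w
      have : w ∈ LinearMap.range α ⊔ LinearMap.range β := by rw [h1]; trivial
      obtain ⟨a, ha, _, ⟨v, rfl⟩, rfl⟩ := Submodule.mem_sup.1 this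
      obtain ⟨⟨x, c⟩, rfl⟩ := hspan v
      exact ⟨⟨⟨a, ha⟩ + ⟨β x, x.2⟩, c⟩, by simp [h, add_assoc]⟩
  refine ⟨LinearEquiv.ofBijective g hg, LinearEquiv.ofBijective h hh, fun x => ?_, fun x => ?_⟩
  · simp [g, h, hσ']
  · simp [g, h]

end Derived

section Uniqueness

open Module

variable {F : Type u} [Field F]

/-- An indecomposable pencil whose first map is not surjective is either exceptional or has an
indecomposable derived pencil whose first map is again not surjective. -/
theorem IsIndecomposable.derived {V W : Type*} [AddCommGroup V] [Module F V] [AddCommGroup W]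
    [Module F W] {α β : V →ₗ[F] W} (hi : IsIndecomposable α β) (hs : ¬ Function.Surjective α)
    (h1 : LinearMap.range α ⊔ LinearMap.range β = ⊤) (h2 : LinearMap.ker α ≤ derivedSource α β) :
    IsIndecomposable (derivedFst α β) (derivedSnd α β) ∧
      ¬ Function.Surjective (derivedFst α β) := by
  have hns : ¬ Function.Surjective (derivedFst α β) := by
    intro hsurj
    have htop : derivedSource α β = ⊤ := by
      rw [eq_top_iff]
      intro v _
      obtain ⟨x, hx⟩ := hsurj ⟨α v, v, rfl⟩
      have hx' : α x = α v := congrArg Subtype.val hx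
      have : v - x ∈ derivedSource α β := h2 (by simp [hx'])
      simpa using Submodule.add_mem _ this x.2
    apply hs
    rw [← LinearMap.range_eq_top, ← h1, left_eq_sup]
    rintro _ ⟨v, rfl⟩
    exact (htop ▸ Submodule.mem_top : v ∈ derivedSource α β)
  refine ⟨isIndecomposable_of_ext (Or.inr ?_) fun C D hc hinj =>
    hi.of_equivalent (equivalent_ext_derived h1 h2 hinj hc).symm, hns⟩
  by_contra hn
  rw [not_nontrivial_iff_subsingleton] at hn
  exact hns fun y => ⟨0, Subsingleton.elim _ _⟩

theorem finrank_range_add_finrank {V W C : Type*} [AddCommGroup V] [Module F V] [AddCommGroup W]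
    [Module F W] [AddCommGroup C] [Module F C] [FiniteDimensional F W] {α : V →ₗ[F] W}
    {ι : C →ₗ[F] W} (hι : Function.Injective ι)
    (hc : IsCompl (LinearMap.range α) (LinearMap.range ι)) :
    finrank F (LinearMap.range α) + finrank F C = finrank F W := by
  rw [← LinearMap.finrank_range_of_inj hι, Submodule.finrank_add_eq_of_isCompl hc]

/-- **Uniqueness of pencils of given dimensions.** An indecomposable pencil whose first map is not
surjective is determined up to isomorphism by the dimensions of its source and target. The image of
the first map has codimension one, so that passing to the derived pencil lowers both dimensions by
one. -/
theorem IsIndecomposable.equivalent_of_not_surjective (n : ℕ) :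
    ∀ {V W : Type u} [AddCommGroup V] [Module F V] [AddCommGroup W] [Module F W]
      [FiniteDimensional F V] [FiniteDimensional F W] {α β : V →ₗ[F] W},
      IsIndecomposable α β → ¬ Function.Surjective α → finrank F W = n →
      finrank F (LinearMap.range α) + 1 = n ∧
      ∀ {V' W' : Type u} [AddCommGroup V'] [Module F V'] [AddCommGroup W'] [Module F W']
        [FiniteDimensional F V'] [FiniteDimensional F W'] {α' β' : V' →ₗ[F] W'},
        IsIndecomposable α' β' → ¬ Function.Surjective α' → finrank F V' = finrank F V →
        finrank F W' = n → Equivalent α β α' β' := by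
  induction n using Nat.strong_induction_on with
  | _ n ih =>
  intro V W _ _ _ _ _ _ α β hi hs hn
  -- the trichotomy: two exceptional pencils, or a derived pencil one step smaller
  have key : ∀ {V W : Type u} [AddCommGroup V] [Module F V] [AddCommGroup W] [Module F W]
      [FiniteDimensional F V] [FiniteDimensional F W] {α β : V →ₗ[F] W},
      IsIndecomposable α β → ¬ Function.Surjective α → finrank F W = n →
      (finrank F V ≤ 1 ∧ n = 1) ∨ (2 ≤ n ∧ LinearMap.range α ⊔ LinearMap.range β = ⊤ ∧
        LinearMap.ker α ≤ derivedSource α β ∧ IsIndecomposable (derivedFst α β) (derivedSnd α β) ∧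
        ¬ Function.Surjective (derivedFst α β) ∧ finrank F (LinearMap.range α) + 1 = n ∧
        finrank F (derivedSource α β) + 1 = finrank F V) := by
    intro V W _ _ _ _ _ _ α β hi hs hn
    rcases hi.range_sup_range with h1 | h1
    swap
    · exact Or.inl ⟨by lia, by lia⟩
    rcases hi.ker_le_comap with h2 | h2
    swap
    · exact Or.inl ⟨by lia, by lia⟩
    right
    obtain ⟨hd, hds⟩ := hi.derived hs h1 h2
    have hlt : finrank F (LinearMap.range α) < n :=
      hn ▸ Submodule.finrank_lt (mt LinearMap.range_eq_top.1 hs)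
    obtain ⟨hcod, -⟩ := ih _ hlt hd hds rfl
    obtain ⟨C, hC⟩ := (LinearMap.range (derivedFst α β)).exists_isCompl
    have hC' : IsCompl (LinearMap.range (derivedFst α β)) (LinearMap.range C.subtype) := by
      rwa [Submodule.range_subtype]
    have hfC : finrank F C = 1 := by
      have := finrank_range_add_finrank C.injective_subtype hC'
      lia
    obtain ⟨g, h, -⟩ := equivalent_ext_derived h1 h2 C.injective_subtype hC'
    have e1 := g.finrank_eq
    have e2 := h.finrank_eq
    rw [finrank_prod, hfC] at e1 e2
    exact ⟨by lia, h1, h2, hd, hds, by lia, e1⟩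
  refine ⟨?_, ?_⟩
  · rcases key hi hs hn with ⟨-, h⟩ | h
    · rw [eq_zero_of_not_surjective hs (hn.trans h), LinearMap.range_zero, finrank_bot, h]
    · exact h.2.2.2.2.2.1
  intro V' W' _ _ _ _ _ _ α' β' hi' hs' hV' hn'
  rcases key hi hs hn with ⟨h, h'⟩ | ⟨h2n, h1, h2, hd, hds, hf, hf'⟩
  · exact equivalent_of_finrank_eq_one hi hi' hs hs' hV' (hn.trans h') (hn'.trans h') h
  rcases key hi' hs' hn' with ⟨h, h'⟩ | ⟨-, h1', h2', hd', hds', hg, hg'⟩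
  · lia
  obtain ⟨g, h, e1, e2⟩ := (ih _ (by lia) hd hds rfl).2 hd' hds' (by lia) (by lia)
  obtain ⟨C, hC⟩ := (LinearMap.range (derivedFst α β)).exists_isCompl
  have hC' : IsCompl (LinearMap.range (derivedFst α β)) (LinearMap.range C.subtype) := by
    rwa [Submodule.range_subtype]
  have hC'' : IsCompl (LinearMap.range (derivedFst α' β'))
      (LinearMap.range ((h : LinearMap.range α →ₗ[F] LinearMap.range α') ∘ₗ C.subtype)) := by
    have hr : LinearMap.range (derivedFst α' β') =
        (LinearMap.range (derivedFst α β)).map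
          (h : LinearMap.range α →ₗ[F] LinearMap.range α') := by
      rw [← LinearMap.range_comp, ← LinearEquiv.range_comp g (derivedFst α' β')]
      exact congrArg LinearMap.range (LinearMap.ext fun v => (e1 v).symm)
    rw [hr, LinearMap.range_comp]
    exact (Submodule.orderIsoMapComap h).isCompl hC'
  exact ((equivalent_ext_derived h1 h2 C.injective_subtype hC').symm.trans
    (Equivalent.ext e1 e2)).trans
    (equivalent_ext_derived h1' h2' (h.injective.comp C.injective_subtype) hC'')

end Uniqueness

end LinearPencil

/-! ### Duality of pencils -/

theorem isCompl_dualCoannihilator {F V : Type*} [Field F] [AddCommGroup V] [Module F V]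
    [FiniteDimensional F V] {P Q : Submodule F (Module.Dual F V)} (h : IsCompl P Q) :
    IsCompl P.dualCoannihilator Q.dualCoannihilator :=
  (Subspace.orderIsoFiniteDimensional (K := F) (V := V)).symm.isCompl h.dual

theorem eq_bot_of_dualCoannihilator_eq_bot {F V : Type*} [Field F] [AddCommGroup V] [Module F V]
    [FiniteDimensional F V] {P Q : Submodule F (Module.Dual F V)} (h : IsCompl P Q)
    (hP : P.dualCoannihilator = ⊥) : Q = ⊥ := by
  have : P = ⊤ := by
    rw [← Subspace.dualCoannihilator_dualAnnihilator_eq (W := P), hP,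
      Submodule.dualAnnihilator_bot]
  simpa [this] using h.inf_eq_bot

namespace LinearPencil

section Duality

open Module

variable {F : Type*} [Field F] {V W V' W' : Type*} [AddCommGroup V] [Module F V]
  [AddCommGroup W] [Module F W] [AddCommGroup V'] [Module F V'] [AddCommGroup W'] [Module F W']
  [FiniteDimensional F V] [FiniteDimensional F W]

theorem IsIndecomposable.dualMap {α β : V →ₗ[F] W}
    (hi : IsIndecomposable α β) : IsIndecomposable α.dualMap β.dualMap := by
  refine ⟨hi.1.symm.imp (fun (_ : Nontrivial W) => inferInstance)
    (fun (_ : Nontrivial V) => inferInstance), fun P Q P' Q' c c' pa pb qa qb => ?_⟩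
  have key : ∀ (R : Submodule F (Dual F W)) (R' : Submodule F (Dual F V)) (γ : V →ₗ[F] W),
      R ≤ R'.comap γ.dualMap → R'.dualCoannihilator ≤ R.dualCoannihilator.comap γ := by
    intro R R' γ h v hv
    rw [Submodule.mem_comap, Submodule.mem_dualCoannihilator]
    intro φ hφ
    exact (Submodule.mem_dualCoannihilator v).1 hv _ (h hφ)
  rcases hi.2 _ _ _ _ (isCompl_dualCoannihilator c') (isCompl_dualCoannihilator c)
    (key _ _ _ pa) (key _ _ _ pb) (key _ _ _ qa) (key _ _ _ qb) with ⟨a, b⟩ | ⟨a, b⟩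
  · exact Or.inr ⟨eq_bot_of_dualCoannihilator_eq_bot c b,
      eq_bot_of_dualCoannihilator_eq_bot c' a⟩
  · exact Or.inl ⟨eq_bot_of_dualCoannihilator_eq_bot c.symm b,
      eq_bot_of_dualCoannihilator_eq_bot c'.symm a⟩

/-- The isomorphism of finite-dimensional spaces whose transpose is the inverse of a given
isomorphism of dual spaces. -/
theorem exists_equiv_dual_apply [FiniteDimensional F V'] (h : Dual F V ≃ₗ[F] Dual F V') :
    ∃ e : V ≃ₗ[F] V', ∀ v φ, h φ (e v) = φ v := by
  refine ⟨(evalEquiv F V).trans (h.symm.dualMap.trans (evalEquiv F V').symm), fun v φ => ?_⟩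
  simp [LinearEquiv.dualMap_apply]

theorem Equivalent.of_dualMap [FiniteDimensional F V'] [FiniteDimensional F W']
    {α β : V →ₗ[F] W} {α' β' : V' →ₗ[F] W'}
    (h : Equivalent α.dualMap β.dualMap α'.dualMap β'.dualMap) : Equivalent α β α' β' := by
  obtain ⟨g, h, h1, h2⟩ := h
  obtain ⟨e, he⟩ := exists_equiv_dual_apply h
  obtain ⟨e', he'⟩ := exists_equiv_dual_apply g
  have key : ∀ (γ : V →ₗ[F] W) (γ' : V' →ₗ[F] W'),
      (∀ φ, h (γ.dualMap φ) = γ'.dualMap (g φ)) → ∀ v, e' (γ v) = γ' (e v) := by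
    intro γ γ' hγ v
    refine (evalEquiv F W').injective (LinearMap.ext fun φ => ?_)
    obtain ⟨ψ, rfl⟩ := g.surjective φ
    have := LinearMap.congr_fun (hγ ψ) (e v)
    rw [he] at this
    simpa [he'] using this
  exact ⟨e, e', key _ _ h1, key _ _ h2⟩

end Duality

section Classification

open Module

variable {F : Type u} [Field F] {V W V' W' : Type u} [AddCommGroup V] [Module F V]
  [AddCommGroup W] [Module F W] [AddCommGroup V'] [Module F V'] [AddCommGroup W'] [Module F W']
  [FiniteDimensional F V] [FiniteDimensional F W] [FiniteDimensional F V'] [FiniteDimensional F W']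

/-- An indecomposable pencil whose first map is not injective is determined up to isomorphism by
the dimensions of its source and target. -/
theorem IsIndecomposable.equivalent_of_not_injective {α β : V →ₗ[F] W} {α' β' : V' →ₗ[F] W'}
    (hi : IsIndecomposable α β) (hs : ¬ Function.Injective α)
    (hi' : IsIndecomposable α' β') (hs' : ¬ Function.Injective α')
    (hV : finrank F V' = finrank F V) (hW : finrank F W' = finrank F W) :
    Equivalent α β α' β' := by
  refine Equivalent.of_dualMap
    ((IsIndecomposable.equivalent_of_not_surjective (finrank F V) hi.dualMap ?_ ?_).2
      hi'.dualMap ?_ ?_ ?_)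
  · rwa [LinearMap.dualMap_surjective_iff]
  · exact Subspace.dual_finrank_eq
  · rwa [LinearMap.dualMap_surjective_iff]
  · rw [Subspace.dual_finrank_eq, Subspace.dual_finrank_eq, hW]
  · rw [Subspace.dual_finrank_eq, hV]

/-- Over an algebraically closed field, a pencil with bijective first map on nonzero spaces has a
singular member. -/
theorem exists_not_surjective_sub_smul [IsAlgClosed F] (α β : V →ₗ[F] W)
    (hV : finrank F V = finrank F W) (h0 : 0 < finrank F V)
    (hα : Function.Bijective α) : ∃ c : F, ¬ Function.Surjective (β - c • α) := by
  have : Nontrivial V := finrank_pos_iff.1 h0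
  let e := LinearEquiv.ofBijective α hα
  obtain ⟨c, hc⟩ := Module.End.exists_eigenvalue ((e.symm : W →ₗ[F] V) ∘ₗ β)
  obtain ⟨v, hv⟩ := hc.exists_hasEigenvector
  refine ⟨c, fun hs => hv.2 ?_⟩
  have hinj := (LinearMap.injective_iff_surjective_of_finrank_eq_finrank hV).2 hs
  refine hinj ?_
  have h1 : e.symm (β v) = c • v := hv.apply_eq_smul
  have h2 : β v = e (c • v) := (LinearEquiv.symm_apply_eq e).1 h1
  have h3 : e (c • v) = c • α v := by rw [map_smul]; rfl
  simp [h2, h3]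

end Classification

end LinearPencil

/-! ### Recognizing indecomposable modules -/

section Generators

variable {F : Type u} [Field F] {A : Type v} [Ring A] [Algebra F A] {x y z : A}

theorem nonempty_linearEquiv_of_adjoin (hgen : Algebra.adjoin F {x, y, z} = ⊤) {M N : Type*}
    [AddCommGroup M] [Module A M] [AddCommGroup N] [Module A N] (e : M ≃+ N)
    (hF : ∀ (c : F) m, e (algebraMap F A c • m) = algebraMap F A c • e m)
    (hx : ∀ m, e (x • m) = x • e m) (hy : ∀ m, e (y • m) = y • e m)
    (hz : ∀ m, e (z • m) = z • e m) : Nonempty (M ≃ₗ[A] N) := by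
  refine ⟨{ e with map_smul' := fun a m => ?_ }⟩
  have ha : a ∈ Algebra.adjoin F {x, y, z} := hgen ▸ Algebra.mem_top
  change e (a • m) = a • e m
  induction ha using Algebra.adjoin_induction generalizing m with
  | mem a ha =>
    rcases ha with rfl | rfl | rfl
    exacts [hx m, hy m, hz m]
  | algebraMap c => exact hF c m
  | add a b _ _ ha hb => rw [add_smul, map_add, ha, hb, add_smul]
  | mul a b _ _ ha hb => rw [mul_smul, ha, hb, mul_smul]

variable {M : Type*} [AddCommGroup M] [Module A M] [Module F M] [IsScalarTower F A M]

/-- A subspace stable under algebra generators, as a submodule. -/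
def Submodule.ofAdjoin (hgen : Algebra.adjoin F {x, y, z} = ⊤) (P : Submodule F M)
    (hx : ∀ m ∈ P, x • m ∈ P) (hy : ∀ m ∈ P, y • m ∈ P) (hz : ∀ m ∈ P, z • m ∈ P) :
    Submodule A M where
  carrier := P
  add_mem' := P.add_mem
  zero_mem' := P.zero_mem
  smul_mem' a m hm := by
    have ha : a ∈ Algebra.adjoin F {x, y, z} := hgen ▸ Algebra.mem_top
    induction ha using Algebra.adjoin_induction generalizing m with
    | mem a ha =>
      rcases ha with rfl | rfl | rfl
      exacts [hx m hm, hy m hm, hz m hm]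
    | algebraMap c => rw [algebraMap_smul]; exact P.smul_mem c hm
    | add a b _ _ ha hb => rw [add_smul]; exact P.add_mem (ha m hm) (hb m hm)
    | mul a b _ _ ha hb => rw [mul_smul]; exact ha _ (hb m hm)

theorem IsIndecomposableModule.eq_bot_or_eq_bot (hi : IsIndecomposableModule A M)
    (hgen : Algebra.adjoin F {x, y, z} = ⊤) {P Q : Submodule F M} (hc : IsCompl P Q)
    (hPx : ∀ m ∈ P, x • m ∈ P) (hPy : ∀ m ∈ P, y • m ∈ P) (hPz : ∀ m ∈ P, z • m ∈ P)
    (hQx : ∀ m ∈ Q, x • m ∈ Q) (hQy : ∀ m ∈ Q, y • m ∈ Q) (hQz : ∀ m ∈ Q, z • m ∈ Q) :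
    P = ⊥ ∨ Q = ⊥ := by
  have hmem : ∀ {R : Submodule F M} {h1 h2 h3} {m : M},
    m ∈ R.ofAdjoin hgen h1 h2 h3 ↔ m ∈ R := Iff.rfl
  have hbot : ∀ {R : Submodule F M} {h1 h2 h3}, R.ofAdjoin hgen h1 h2 h3 = ⊥ → R = ⊥ := by
    intro R h1 h2 h3 h
    rw [Submodule.eq_bot_iff] at h ⊢
    exact h
  refine (hi.2 (P.ofAdjoin hgen hPx hPy hPz) (Q.ofAdjoin hgen hQx hQy hQz) ⟨?_, ?_⟩).imp hbot hbot
  · rw [Submodule.disjoint_def]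
    intro m hm hm'
    exact Submodule.disjoint_def.1 hc.disjoint m hm hm'
  · rw [codisjoint_iff, eq_top_iff]
    intro m _
    have : m ∈ P ⊔ Q := by rw [hc.sup_eq_top]; trivial
    obtain ⟨p, hp, q, hq, rfl⟩ := Submodule.mem_sup.1 this
    exact Submodule.add_mem_sup (hmem.2 hp) (hmem.2 hq)

open Matrix in
variable (x y z M) in
/-- The module `M` has a basis in which the elements `x`, `y`, `z` of the algebra act by the
matrices `X`, `Y`, `Z`. -/
def HasMatrices {k : ℕ} (X Y Z : Matrix (Fin k) (Fin k) F) : Prop :=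
  ∃ e : M ≃ₗ[F] (Fin k → F), ∀ m, e (x • m) = X *ᵥ e m ∧ e (y • m) = Y *ᵥ e m ∧ e (z • m) = Z *ᵥ e m

theorem HasMatrices.nonempty_linearEquiv (hgen : Algebra.adjoin F {x, y, z} = ⊤) {N : Type*}
    [AddCommGroup N] [Module A N] [Module F N] [IsScalarTower F A N] {k : ℕ}
    {X Y Z : Matrix (Fin k) (Fin k) F} (hM : HasMatrices x y z M X Y Z)
    (hN : HasMatrices x y z N X Y Z) : Nonempty (M ≃ₗ[A] N) := by
  obtain ⟨e, he⟩ := hM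
  obtain ⟨e', he'⟩ := hN
  refine nonempty_linearEquiv_of_adjoin hgen (e.trans e'.symm).toAddEquiv ?_ ?_ ?_ ?_
  · intro c m
    simp only [algebraMap_smul]
    exact (e.trans e'.symm).map_smul c m
  all_goals
    intro m
    refine e'.injective ?_
    have h := he m
    have h' := he' (e'.symm (e m))
    simp_all

open Matrix in
/-- **Splitting by a frame.** Suppose that the span of the vectors `v i` and the common kernel of
the functionals `f i` are both stable under the generators of the algebra, and that the matrix of
the values `f i (v j)` is invertible. Then the span is a direct summand, so it is everything if the
module is indecomposable. -/
theorem IsIndecomposableModule.hasMatrices_of_frame (hi : IsIndecomposableModule A M)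
    (hgen : Algebra.adjoin F {x, y, z} = ⊤) {k : ℕ} [NeZero k] (v : Fin k → M)
    (f : Fin k → M →ₗ[F] F) (hD : (Matrix.of fun i j => f i (v j)).det ≠ 0)
    (X Y Z : Matrix (Fin k) (Fin k) F)
    (hX : ∀ j, x • v j = ∑ i, X i j • v i) (hY : ∀ j, y • v j = ∑ i, Y i j • v i)
    (hZ : ∀ j, z • v j = ∑ i, Z i j • v i)
    (hfx : ∀ m, (∀ i, f i m = 0) → ∀ i, f i (x • m) = 0)
    (hfy : ∀ m, (∀ i, f i m = 0) → ∀ i, f i (y • m) = 0)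
    (hfz : ∀ m, (∀ i, f i m = 0) → ∀ i, f i (z • m) = 0) :
    HasMatrices x y z M X Y Z := by
  set D : Matrix (Fin k) (Fin k) F := Matrix.of fun i j => f i (v j) with hDdef
  let T : (Fin k → F) →ₗ[F] M := Fintype.linearCombination F v
  let φ : M →ₗ[F] (Fin k → F) := LinearMap.pi f
  have hT : ∀ c, T c = ∑ i, c i • v i := fun c => Fintype.linearCombination_apply F v c
  have hφT : ∀ c, φ (T c) = D *ᵥ c := by
    intro c
    ext i
    simp [φ, hT, D, Matrix.mulVec, dotProduct, mul_comm]
  have hφ : ∀ m, φ m = 0 ↔ ∀ i, f i m = 0 := fun m => by simp [φ, funext_iff]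
  have hDu : IsUnit D.det := isUnit_iff_ne_zero.2 hD
  have hDinj : ∀ c, D *ᵥ c = 0 → c = 0 := fun c hc => by
    by_contra hne
    exact hD (Matrix.exists_mulVec_eq_zero_iff.1 ⟨c, hne, hc⟩)
  have hact : ∀ (w : A) (C : Matrix (Fin k) (Fin k) F), (∀ j, w • v j = ∑ i, C i j • v i) →
      ∀ c, w • T c = T (C *ᵥ c) := by
    intro w C hC c
    simp only [hT, Matrix.mulVec, dotProduct, Finset.smul_sum, Finset.sum_smul]
    rw [Finset.sum_comm]
    refine Finset.sum_congr rfl fun j _ => ?_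
    rw [smul_comm, hC, Finset.smul_sum]
    exact Finset.sum_congr rfl fun i _ => by rw [smul_smul, mul_comm]
  have hc : IsCompl (LinearMap.range T) (LinearMap.ker φ) := by
    constructor
    · rw [Submodule.disjoint_def]
      rintro _ ⟨c, rfl⟩ hm
      rw [LinearMap.mem_ker, hφT] at hm
      rw [hDinj c hm, map_zero]
    · rw [codisjoint_iff, eq_top_iff]
      intro m _
      refine Submodule.mem_sup.2 ⟨T (D⁻¹ *ᵥ φ m), ⟨_, rfl⟩, m - T (D⁻¹ *ᵥ φ m), ?_, by simp⟩
      rw [LinearMap.mem_ker, map_sub, hφT, Matrix.mulVec_mulVec, Matrix.mul_nonsing_inv _ hDu,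
        Matrix.one_mulVec, sub_self]
  have hTinj : Function.Injective T := by
    rw [← LinearMap.ker_eq_bot, LinearMap.ker_eq_bot']
    intro c hc
    exact hDinj c (by rw [← hφT, hc, map_zero])
  have hstab : ∀ (w : A) (C : Matrix (Fin k) (Fin k) F), (∀ j, w • v j = ∑ i, C i j • v i) →
      ∀ m ∈ LinearMap.range T, w • m ∈ LinearMap.range T := by
    rintro w C hC _ ⟨c, rfl⟩
    exact ⟨_, (hact w C hC c).symm⟩
  have hTsurj : Function.Surjective T := by
    rcases hi.eq_bot_or_eq_bot hgen hc (hstab x X hX) (hstab y Y hY) (hstab z Z hZ)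
      (fun m hm => (hφ _).2 (hfx m ((hφ m).1 hm))) (fun m hm => (hφ _).2 (hfy m ((hφ m).1 hm)))
      (fun m hm => (hφ _).2 (hfz m ((hφ m).1 hm))) with h | h
    · exfalso
      have h1 : T (Pi.single 0 1) = 0 := by
        rw [← Submodule.mem_bot F, ← h]; exact ⟨_, rfl⟩
      have h2 := hTinj (h1.trans (map_zero T).symm)
      simpa using congrFun h2 0
    · rw [← LinearMap.range_eq_top]
      simpa [h] using hc.sup_eq_top
  refine ⟨(LinearEquiv.ofBijective T ⟨hTinj, hTsurj⟩).symm, fun m => ?_⟩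
  obtain ⟨c, rfl⟩ := hTsurj m
  have hs : ∀ c, (LinearEquiv.ofBijective T ⟨hTinj, hTsurj⟩).symm (T c) = c := fun c =>
    (LinearEquiv.ofBijective T ⟨hTinj, hTsurj⟩).symm_apply_apply c
  refine ⟨?_, ?_, ?_⟩
  · rw [hact x X hX, hs, hs]
  · rw [hact y Y hY, hs, hs]
  · rw [hact z Z hZ, hs, hs]

end Generators

section Representatives

/-- If a class of objects is covered by finitely many subclasses, each consisting of pairwise
isomorphic objects, then finitely many objects represent it up to isomorphism. -/
theorem exists_finite_representatives {X C : Type*} [Finite C] (R : C → X → Prop)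
    (iso : X → X → Prop) (h : ∀ c s t, R c s → R c t → iso s t) :
    ∃ S : Set X, S.Finite ∧ ∀ c s, R c s → ∃ t ∈ S, iso s t := by
  classical
  refine ⟨Set.range fun c : {c : C // ∃ s, R c s} => c.2.choose, Set.finite_range _, ?_⟩
  intro c s hs
  exact ⟨_, ⟨⟨c, s, hs⟩, rfl⟩, h c _ _ hs (Exists.choose_spec (⟨s, hs⟩ : ∃ s, R c s))⟩

variable {F : Type u} [Field F] {A : Type v} [Ring A] [Algebra F A] {x y z : A}

theorem hasFiniteRepType_of_matrices (hgen : Algebra.adjoin F {x, y, z} = ⊤)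
    (𝒞 : Set (Σ k : ℕ, Matrix (Fin k) (Fin k) F × Matrix (Fin k) (Fin k) F ×
      Matrix (Fin k) (Fin k) F)) (h𝒞 : 𝒞.Finite)
    (h : ∀ (M : Type u) [AddCommGroup M] [Module A M] [Module F M] [IsScalarTower F A M]
      [Module.Finite F M], IsIndecomposableModule A M →
      ∃ C ∈ 𝒞, HasMatrices x y z M C.2.1 C.2.2.1 C.2.2.2) : HasFiniteRepType F A := by
  have := h𝒞.to_subtype
  let inst (N : ModuleCat.{u} A) : Module F N := Module.restrictScalars F A N
  have tower (N : ModuleCat.{u} A) : IsScalarTower F A N := IsScalarTower.restrictScalars F A N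
  obtain ⟨S, hS, hcov⟩ := exists_finite_representatives
    (fun (C : 𝒞) (N : ModuleCat.{u} A) => HasMatrices x y z N C.1.2.1 C.1.2.2.1 C.1.2.2.2)
    (fun N N' => Nonempty (N ≃ₗ[A] N')) (fun C N N' hN hN' => hN.nonempty_linearEquiv hgen hN')
  refine ⟨S, hS, fun N hN hi => ?_⟩
  have : Module.Finite F N := hN
  obtain ⟨C, hC, hN⟩ := h N hi
  exact hcov ⟨C, hC⟩ N hN

end Representatives

/-! ### Three families of algebras of finite representation type -/

section FiniteType

variable {F : Type u} [Field F] {A : Type v} [Ring A] [Algebra F A] {x y z : A}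
  {M : Type*} [AddCommGroup M] [Module A M] [Module F M] [IsScalarTower F A M]

theorem exists_functional_ne_zero {V : Type*} [AddCommGroup V] [Module F V] {v : V} (hv : v ≠ 0) :
    ∃ φ : V →ₗ[F] F, φ v ≠ 0 := by
  obtain ⟨φ, hφ, -⟩ := Submodule.exists_le_ker_of_notMem (K := F) (p := ⊥) (v := v) (by simpa)
  exact ⟨φ, hφ⟩

/-- A common eigenvector and a common left eigenfunctional, for the same eigenvalues, which do not
annihilate each other split off. -/
theorem IsIndecomposableModule.hasMatrices_of_eigenvector (hi : IsIndecomposableModule A M)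
    (hgen : Algebra.adjoin F {x, y, z} = ⊤) {v : M} {f : M →ₗ[F] F} (hv : f v ≠ 0) {a b c : F}
    (hx : x • v = a • v) (hy : y • v = b • v) (hz : z • v = c • v)
    (hfx : ∀ m, f (x • m) = a • f m) (hfy : ∀ m, f (y • m) = b • f m)
    (hfz : ∀ m, f (z • m) = c • f m) : HasMatrices x y z M !![a] !![b] !![c] := by
  refine hi.hasMatrices_of_frame hgen ![v] ![f] (by simpa [Matrix.det_unique] using hv) _ _ _
    ?_ ?_ ?_ ?_ ?_ ?_
  all_goals simp_all

/-- An idempotent commuting with the algebra acts on an indecomposable module as `0` or `1`. -/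
theorem IsIndecomposableModule.idempotent_smul (hi : IsIndecomposableModule A M)
    (hgen : Algebra.adjoin F {x, y, z} = ⊤) {e : A} (he : ∀ m : M, e • e • m = e • m)
    (hx : ∀ m : M, e • x • m = x • e • m) (hy : ∀ m : M, e • y • m = y • e • m)
    (hz : ∀ m : M, e • z • m = z • e • m) : (∀ m : M, e • m = 0) ∨ ∀ m : M, e • m = m := by
  let L : M →ₗ[F] M := Algebra.lsmul F F M e
  have hL : ∀ m, L m = e • m := fun m => rfl
  have hc : IsCompl (LinearMap.range L) (LinearMap.ker L) := by
    constructor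
    · rw [Submodule.disjoint_def]
      rintro _ ⟨m, rfl⟩ hm
      rwa [LinearMap.mem_ker, hL, hL, he] at hm
    · rw [codisjoint_iff, eq_top_iff]
      intro m _
      exact Submodule.mem_sup.2 ⟨L m, ⟨m, rfl⟩, m - L m, by simp [hL, smul_sub, he], by simp⟩
  have hr : ∀ w : A, (∀ m : M, e • w • m = w • e • m) →
      ∀ m ∈ LinearMap.range L, w • m ∈ LinearMap.range L := by
    rintro w hw _ ⟨m, rfl⟩
    exact ⟨w • m, hw m⟩
  have hk : ∀ w : A, (∀ m : M, e • w • m = w • e • m) →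
      ∀ m ∈ LinearMap.ker L, w • m ∈ LinearMap.ker L := by
    intro w hw m hm
    rw [LinearMap.mem_ker, hL] at hm ⊢
    rw [hw, hm, smul_zero]
  rcases hi.eq_bot_or_eq_bot hgen hc (hr x hx) (hr y hy) (hr z hz) (hk x hx) (hk y hy) (hk z hz)
    with h | h
  · left
    intro m
    have : L m ∈ LinearMap.range L := ⟨m, rfl⟩
    rw [h] at this
    exact this
  · right
    intro m
    have : m - L m ∈ LinearMap.ker L := by simp [hL, smul_sub, he]
    rw [h, Submodule.mem_bot, sub_eq_zero] at this
    exact this.symm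

/-- Triples of matrices of a common size. -/
abbrev MatrixTriple (F : Type u) : Type u :=
  Σ k : ℕ, Matrix (Fin k) (Fin k) F × Matrix (Fin k) (Fin k) F × Matrix (Fin k) (Fin k) F

variable (x y z M) in
/-- The elements `x`, `y`, `z` act on `M` by the triple of matrices `C` in some basis. -/
abbrev HasTriple (C : MatrixTriple F) : Prop := HasMatrices x y z M C.2.1 C.2.2.1 C.2.2.2

/-- Matrices describing the indecomposable modules on which `x` and `y` act by scalars `a` and `b`,
and `z` satisfies `z² = c z`. -/
def scalarTriples (a b c : F) : Set (MatrixTriple F) :=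
  {⟨1, !![a], !![b], !![0]⟩, ⟨1, !![a], !![b], !![c]⟩,
    ⟨2, !![a, 0; 0, a], !![b, 0; 0, b], !![0, 0; 1, 0]⟩}

theorem finite_scalarTriples (a b c : F) : (scalarTriples a b c).Finite := by
  unfold scalarTriples
  exact Set.toFinite _

theorem IsIndecomposableModule.exists_scalarTriple (hi : IsIndecomposableModule A M)
    (hgen : Algebra.adjoin F {x, y, z} = ⊤) {a b c : F} (hx : ∀ m : M, x • m = a • m)
    (hy : ∀ m : M, y • m = b • m) (hz : ∀ m : M, z • z • m = c • z • m) :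
    ∃ C ∈ scalarTriples a b c, HasTriple x y z M C := by
  by_cases h0 : ∀ m : M, z • m = 0
  · have := hi.1
    obtain ⟨v, hv⟩ := exists_ne (0 : M)
    obtain ⟨φ, hφ⟩ := exists_functional_ne_zero (F := F) hv
    refine ⟨⟨1, !![a], !![b], !![0]⟩, by simp [scalarTriples], ?_⟩
    exact hi.hasMatrices_of_eigenvector hgen hφ (hx v) (hy v) (by simp [h0]) (by simp [hx])
      (by simp [hy]) (by simp [h0])
  push Not at h0
  obtain ⟨m, hm⟩ := h0
  obtain ⟨φ, hφ⟩ := exists_functional_ne_zero (F := F) hm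
  by_cases hc : c = 0
  · subst hc
    refine ⟨⟨2, !![a, 0; 0, a], !![b, 0; 0, b], !![0, 0; 1, 0]⟩, by simp [scalarTriples], ?_⟩
    refine hi.hasMatrices_of_frame hgen ![m, z • m] ![φ ∘ₗ Algebra.lsmul F F M z, φ] ?_ _ _ _
      ?_ ?_ ?_ ?_ ?_ ?_
    · simp [Matrix.det_fin_two, hz, hφ]
    all_goals simp +contextual [Fin.forall_fin_two, Fin.sum_univ_two, hx, hy, hz]
  · refine ⟨⟨1, !![a], !![b], !![c]⟩, by simp [scalarTriples], ?_⟩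
    refine hi.hasMatrices_of_eigenvector (f := φ ∘ₗ Algebra.lsmul F F M z) hgen (v := z • m) ?_
      (hx _) (hy _) (hz m) ?_ ?_ ?_
    · simp [hz, hc, hφ]
    all_goals simp [hx, hy, hz]

/-- The algebra is a quotient of the product of two copies of the ground field and of
`F[z] / (z² - c z)`. -/
theorem hasFiniteRepType_of_orthogonal_idempotents {e f z : A} {c : F}
    (hgen : Algebra.adjoin F {e, f, z} = ⊤) (hee : e * e = e) (hff : f * f = f) (hef : e * f = 0)
    (hfe : f * e = 0) (hez : e * z = 0) (hze : z * e = 0) (hfz : f * z = 0) (hzf : z * f = 0)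
    (hzz : z * z = c • z) : HasFiniteRepType F A := by
  refine hasFiniteRepType_of_matrices hgen (⋃ a ∈ ({0, 1} : Set F), ⋃ b ∈ ({0, 1} : Set F),
    scalarTriples a b c) ?_ ?_
  · exact Set.Finite.biUnion (Set.toFinite _) fun a _ => Set.Finite.biUnion (Set.toFinite _)
      fun b _ => finite_scalarTriples a b c
  · intro M _ _ _ _ _ hi
    have key : ∀ {g : A}, ((∀ m : M, g • m = 0) ∨ ∀ m : M, g • m = m) →
        ∃ a ∈ ({0, 1} : Set F), ∀ m : M, g • m = a • m := by
      rintro g (h | h)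
      · exact ⟨0, by simp, by simpa using h⟩
      · exact ⟨1, by simp, by simpa using h⟩
    obtain ⟨a, ha, hea⟩ := key (hi.idempotent_smul hgen (e := e) (by simp [smul_smul, hee])
      (by simp) (by simp [smul_smul, hef, hfe]) (by simp [smul_smul, hez, hze]))
    obtain ⟨b, hb, hfb⟩ := key (hi.idempotent_smul hgen (e := f) (by simp [smul_smul, hff])
      (by simp [smul_smul, hef, hfe]) (by simp) (by simp [smul_smul, hfz, hzf]))
    obtain ⟨C, hC, h⟩ := hi.exists_scalarTriple hgen hea hfb (c := c)
      (fun m => by rw [smul_smul, hzz, smul_assoc])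
    exact ⟨C, Set.mem_biUnion ha (Set.mem_biUnion hb hC), h⟩

/-- The algebra is a quotient of the path algebra of the quiver with one arrow `y` into the vertex
of the idempotent `e` and a loop `z` at the source of the arrow, modulo `y z = 0` and `z² = c z`. -/
theorem hasFiniteRepType_of_loop_at_source {e y z : A} {c : F}
    (hgen : Algebra.adjoin F {e, y, z} = ⊤) (hee : e * e = e) (hey : e * y = y) (hye : y * e = 0)
    (hez : e * z = 0) (hze : z * e = 0) (hyz : y * z = 0) (hzz : z * z = c • z) :
    HasFiniteRepType F A := by
  refine hasFiniteRepType_of_matrices hgen (scalarTriples 0 0 c ∪ scalarTriples 1 0 c ∪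
    {⟨2, !![0, 0; 0, 1], !![0, 0; 1, 0], 0⟩,
      ⟨3, !![0, 0, 0; 0, 1, 0; 0, 0, 0], !![0, 0, 0; 1, 0, 0; 0, 0, 0],
        !![0, 0, 0; 0, 0, 0; 1, 0, 0]⟩}) ?_ ?_
  · exact ((finite_scalarTriples _ _ _).union (finite_scalarTriples _ _ _)).union (Set.toFinite _)
  intro M _ _ _ _ _ hi
  have ee : ∀ m : M, e • e • m = e • m := by simp [smul_smul, hee]
  have ey : ∀ m : M, e • y • m = y • m := by simp [smul_smul, hey]
  have ye : ∀ m : M, y • e • m = 0 := by simp [smul_smul, hye]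
  have ez : ∀ m : M, e • z • m = 0 := by simp [smul_smul, hez]
  have ze : ∀ m : M, z • e • m = 0 := by simp [smul_smul, hze]
  have yz : ∀ m : M, y • z • m = 0 := by simp [smul_smul, hyz]
  have yy : ∀ m : M, y • y • m = 0 := fun m => by rw [← ey m, ye]
  have zy : ∀ m : M, z • y • m = 0 := fun m => by rw [← ey m, ze]
  have zz : ∀ m : M, z • z • m = c • z • m := fun m => by rw [smul_smul, hzz, smul_assoc]
  by_cases hy0 : ∀ m : M, y • m = 0
  · rcases hi.idempotent_smul hgen ee (by simp) (by simp [hy0]) (by simp [ez, ze]) with h | h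
    · obtain ⟨C, hC, h⟩ := hi.exists_scalarTriple hgen (a := 0) (b := 0) (by simpa using h)
        (by simpa using hy0) zz
      exact ⟨C, Or.inl (Or.inl hC), h⟩
    · obtain ⟨C, hC, h⟩ := hi.exists_scalarTriple hgen (a := 1) (b := 0) (by simpa using h)
        (by simpa using hy0) zz
      exact ⟨C, Or.inl (Or.inr hC), h⟩
  by_cases h1 : ∃ m : M, e • m = 0 ∧ z • m = 0 ∧ y • m ≠ 0
  · obtain ⟨m, em, zm, ym⟩ := h1
    obtain ⟨φ, hφ⟩ := exists_functional_ne_zero (F := F) ym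
    refine ⟨⟨2, !![0, 0; 0, 1], !![0, 0; 1, 0], 0⟩, by simp, ?_⟩
    refine hi.hasMatrices_of_frame hgen ![m, y • m]
      ![φ ∘ₗ Algebra.lsmul F F M y, φ ∘ₗ Algebra.lsmul F F M e] ?_ _ _ _ ?_ ?_ ?_ ?_ ?_ ?_
    · simp [Matrix.det_fin_two, yy, em, ey, hφ]
    all_goals simp +contextual [Fin.forall_fin_two, Fin.sum_univ_two, em, zm, ee, ey, ye, yy, zy,
      yz, ez]
  -- otherwise `y` factors through `z`
  push Not at h1 hy0
  have hker : ∀ m : M, z • m = 0 → y • m = 0 := by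
    intro m hm
    simpa [smul_sub, ye] using h1 (m - e • m) (by simp [smul_sub, ee]) (by simp [smul_sub, hm, ze])
  obtain ⟨m₀, hm₀⟩ := hy0
  obtain ⟨m, em, ym⟩ : ∃ m : M, e • m = 0 ∧ y • m ≠ 0 :=
    ⟨m₀ - e • m₀, by simp [smul_sub, ee], by simpa [smul_sub, ye] using hm₀⟩
  obtain ⟨φ, hφ⟩ := exists_functional_ne_zero (F := F) ym
  obtain ⟨χ, hχ⟩ : ∃ χ : M →ₗ[F] F, ∀ m, χ (z • m) = φ (y • m) := by
    have : φ ∘ₗ Algebra.lsmul F F M y ∈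
        LinearMap.range (LinearMap.dualMap (Algebra.lsmul F F M z : M →ₗ[F] M)) := by
      rw [LinearMap.range_dualMap_eq_dualAnnihilator_ker, Submodule.mem_dualAnnihilator]
      intro m hm
      have := hker m hm
      simp [this]
    obtain ⟨χ, hχ⟩ := this
    exact ⟨χ, fun m => LinearMap.congr_fun hχ m⟩
  have hc : c = 0 := by
    by_contra hc
    have := hχ (z • m)
    rw [zz, yz, map_zero, map_smul, hχ, smul_eq_mul] at this
    exact (mul_ne_zero hc hφ) this
  subst hc
  simp only [zero_smul] at zz
  refine ⟨⟨3, !![0, 0, 0; 0, 1, 0; 0, 0, 0], !![0, 0, 0; 1, 0, 0; 0, 0, 0],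
        !![0, 0, 0; 0, 0, 0; 1, 0, 0]⟩, by simp, ?_⟩
  refine hi.hasMatrices_of_frame hgen ![m, y • m, z • m]
      ![φ ∘ₗ Algebra.lsmul F F M y, φ ∘ₗ Algebra.lsmul F F M e,
        χ - χ ∘ₗ Algebra.lsmul F F M e] ?_ _ _ _ ?_ ?_ ?_ ?_ ?_ ?_
  · simp [Matrix.det_fin_three, yy, yz, em, ey, ez, hχ, hφ]
  all_goals simp +contextual [Fin.forall_fin_succ, Fin.sum_univ_succ, em, ee, ey, ye, yy, zy,
      yz, ez, zz, hχ]

/-- The algebra is a quotient of the path algebra of the quiver with one arrow `y` into the vertex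
of the idempotent `e` and a loop `z` at this vertex, modulo `z y = 0` and `z² = 0`. -/
theorem hasFiniteRepType_of_loop_at_target {e y z : A}
    (hgen : Algebra.adjoin F {e, y, z} = ⊤) (hee : e * e = e) (hey : e * y = y) (hye : y * e = 0)
    (hez : e * z = z) (hze : z * e = z) (hzy : z * y = 0) (hzz : z * z = 0) :
    HasFiniteRepType F A := by
  refine hasFiniteRepType_of_matrices hgen (scalarTriples 0 0 0 ∪ scalarTriples 1 0 0 ∪
    {⟨2, !![0, 0; 0, 1], !![0, 0; 1, 0], 0⟩,
      ⟨3, !![1, 0, 0; 0, 0, 0; 0, 0, 1], !![0, 0, 0; 0, 0, 0; 0, 1, 0],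
        !![0, 0, 0; 0, 0, 0; 1, 0, 0]⟩}) ?_ ?_
  · exact ((finite_scalarTriples _ _ _).union (finite_scalarTriples _ _ _)).union (Set.toFinite _)
  intro M _ _ _ _ _ hi
  have ee : ∀ m : M, e • e • m = e • m := by simp [smul_smul, hee]
  have ey : ∀ m : M, e • y • m = y • m := by simp [smul_smul, hey]
  have ye : ∀ m : M, y • e • m = 0 := by simp [smul_smul, hye]
  have ez : ∀ m : M, e • z • m = z • m := by simp [smul_smul, hez]
  have ze : ∀ m : M, z • e • m = z • m := by simp [smul_smul, hze]
  have zy : ∀ m : M, z • y • m = 0 := by simp [smul_smul, hzy]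
  have zz : ∀ m : M, z • z • m = 0 := by simp [smul_smul, hzz]
  have yy : ∀ m : M, y • y • m = 0 := fun m => by rw [← ey m, ye]
  have yz : ∀ m : M, y • z • m = 0 := fun m => by rw [← ez m, ye]
  have z0 : ∀ m : M, e • m = 0 → z • m = 0 := fun m hm => by rw [← ze, hm, smul_zero]
  by_cases hy0 : ∀ m : M, y • m = 0
  · rcases hi.idempotent_smul hgen ee (by simp) (by simp [hy0]) (by simp [ez, ze]) with h | h
    · obtain ⟨C, hC, h⟩ := hi.exists_scalarTriple hgen (a := 0) (b := 0) (c := 0)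
        (by simpa using h) (by simpa using hy0) (by simpa using zz)
      exact ⟨C, Or.inl (Or.inl hC), h⟩
    · obtain ⟨C, hC, h⟩ := hi.exists_scalarTriple hgen (a := 1) (b := 0) (c := 0)
        (by simpa using h) (by simpa using hy0) (by simpa using zz)
      exact ⟨C, Or.inl (Or.inr hC), h⟩
  push Not at hy0
  by_cases h1 : ∃ m w : M, y • m = z • w ∧ y • m ≠ 0
  · obtain ⟨m, em, w, ew, hmw, ym⟩ : ∃ m : M, e • m = 0 ∧ ∃ w : M, e • w = w ∧ y • m = z • w ∧
        y • m ≠ 0 := by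
      obtain ⟨m, w, h, h'⟩ := h1
      exact ⟨m - e • m, by simp [smul_sub, ee], e • w, ee w, by simp [smul_sub, ye, ze, h],
        by simpa [smul_sub, ye] using h'⟩
    have yw : y • w = 0 := by rw [← ew, ye]
    obtain ⟨φ, hφ⟩ := exists_functional_ne_zero (F := F) ym
    refine ⟨⟨3, !![1, 0, 0; 0, 0, 0; 0, 0, 1], !![0, 0, 0; 0, 0, 0; 0, 1, 0],
        !![0, 0, 0; 0, 0, 0; 1, 0, 0]⟩, by simp, ?_⟩
    refine hi.hasMatrices_of_frame hgen ![w, m, y • m]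
      ![φ ∘ₗ Algebra.lsmul F F M z, φ ∘ₗ Algebra.lsmul F F M y,
        φ ∘ₗ Algebra.lsmul F F M e] ?_ _ _ _ ?_ ?_ ?_ ?_ ?_ ?_
    · simp [Matrix.det_fin_three, ← hmw, yy, em, ew, ey, yw, zy, z0 m em, hφ]
    all_goals simp +contextual [Fin.forall_fin_succ, Fin.sum_univ_succ, ← hmw, em, ew, ee, ey,
      ye, yy, zy, yz, ez, ze, zz, yw, z0 m em]
  · push Not at h1
    obtain ⟨m₀, hm₀⟩ := hy0
    obtain ⟨m, em, ym⟩ : ∃ m : M, e • m = 0 ∧ y • m ≠ 0 :=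
      ⟨m₀ - e • m₀, by simp [smul_sub, ee], by simpa [smul_sub, ye] using hm₀⟩
    have hnot : y • m ∉ LinearMap.range (Algebra.lsmul F F M z : M →ₗ[F] M) := by
      rintro ⟨w, hw⟩
      exact ym (h1 m w hw.symm)
    obtain ⟨φ, hφ, hle⟩ := Submodule.exists_le_ker_of_notMem hnot
    have hφz : ∀ w, φ (z • w) = 0 := fun w => hle ⟨w, rfl⟩
    refine ⟨⟨2, !![0, 0; 0, 1], !![0, 0; 1, 0], 0⟩, by simp, ?_⟩
    refine hi.hasMatrices_of_frame hgen ![m, y • m]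
      ![φ ∘ₗ Algebra.lsmul F F M y, φ ∘ₗ Algebra.lsmul F F M e] ?_ _ _ _ ?_ ?_ ?_ ?_ ?_ ?_
    · simp [Matrix.det_fin_two, yy, em, ey, hφ]
    all_goals simp +contextual [Fin.forall_fin_two, Fin.sum_univ_two, em, ee, ey, ye, yy, zy,
      yz, ez, z0 m em, hφz]

end FiniteType

/-! ### Local algebras with one-dimensional socle and modules over them -/

/-- A four-dimensional local algebra with basis `1, x, y, z`, whose radical is spanned by `x, y, z`
and whose socle is spanned by `z`. The multiplication of `x` and `y` is given by the symmetric
matrix with diagonal entries `p` and off-diagonal entries `q`; it is nondegenerate, so that the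
algebra is symmetric. -/
structure IsLocalSymmetric {F : Type u} [Field F] {A : Type v} [Ring A] [Algebra F A] (x y z : A)
    (p q : F) : Prop where
  linearIndependent : LinearIndependent F ![1, x, y, z]
  span_eq_top : ⊤ ≤ Submodule.span F (Set.range ![1, x, y, z])
  xx : x * x = p • z
  xy : x * y = q • z
  yx : y * x = q • z
  yy : y * y = p • z
  xz : x * z = 0
  zx : z * x = 0
  yz : y * z = 0
  zy : z * y = 0
  zz : z * z = 0
  nondegenerate : p * p - q * q ≠ 0

section Local

variable {F : Type u} [Field F] {A : Type v} [Ring A] [Algebra F A] {x y z : A} {p q : F}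

theorem IsLocalSymmetric.adjoin_eq_top (h : IsLocalSymmetric x y z p q) :
    Algebra.adjoin F {x, y, z} = ⊤ := by
  rw [eq_top_iff, ← Subalgebra.toSubmodule.le_iff_le, Algebra.top_toSubmodule]
  refine h.span_eq_top.trans (Submodule.span_le.2 ?_)
  rintro _ ⟨i, rfl⟩
  fin_cases i
  · exact one_mem (Algebra.adjoin F {x, y, z})
  all_goals exact Algebra.subset_adjoin (by simp)

/-- Elements of an algebra whose products all vanish define a homomorphism killing the socle. -/
theorem IsLocalSymmetric.exists_algHom (h : IsLocalSymmetric x y z p q) {E : Type*} [Ring E]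
    [Algebra F E] {X Y : E} (hXX : X * X = 0) (hXY : X * Y = 0) (hYX : Y * X = 0)
    (hYY : Y * Y = 0) : ∃ Φ : A →ₐ[F] E, Φ x = X ∧ Φ y = Y ∧ Φ z = 0 := by
  let b : Module.Basis (Fin 4) F A := Module.Basis.mk h.linearIndependent h.span_eq_top
  let L : A →ₗ[F] E := b.constr F ![1, X, Y, 0]
  have hb : ∀ i, b i = (![1, x, y, z] : Fin 4 → A) i := fun i => by simp [b]
  have hL : ∀ i, L ((![1, x, y, z] : Fin 4 → A) i) = (![1, X, Y, 0] : Fin 4 → E) i := fun i => by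
    rw [← hb, Module.Basis.constr_basis]
  have L1 : L 1 = 1 := hL 0
  have Lx : L x = X := hL 1
  have Ly : L y = Y := hL 2
  have Lz : L z = 0 := hL 3
  have hmul : (LinearMap.mul F A).compr₂ L = (LinearMap.mul F E).compl₁₂ L L := by
    refine b.ext fun i => b.ext fun j => ?_
    rw [hb, hb]
    fin_cases i <;> fin_cases j <;>
      simp [L1, Lx, Ly, Lz, h.xx, h.xy, h.yx, h.yy, h.xz, h.zx, h.yz, h.zy, h.zz, hXX, hXY, hYX,
        hYY]
  exact ⟨AlgHom.ofLinearMap L L1 fun r s => LinearMap.congr_fun₂ hmul r s, Lx, Ly, Lz⟩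

variable {M : Type*} [AddCommGroup M] [Module A M] [Module F M] [IsScalarTower F A M]

/-- An indecomposable module not killed by the socle is free of rank one, since the algebra is
self-injective. -/
theorem IsLocalSymmetric.hasMatrices (h : IsLocalSymmetric x y z p q)
    (hi : IsIndecomposableModule A M) (hz : ¬ ∀ m : M, z • m = 0) :
    HasMatrices x y z M !![0, 0, 0, 0; 1, 0, 0, 0; 0, 0, 0, 0; 0, p, q, 0]
      !![0, 0, 0, 0; 0, 0, 0, 0; 1, 0, 0, 0; 0, q, p, 0]
      !![0, 0, 0, 0; 0, 0, 0, 0; 0, 0, 0, 0; 1, 0, 0, 0] := by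
  push Not at hz
  obtain ⟨m, hm⟩ := hz
  obtain ⟨φ, hφ⟩ := exists_functional_ne_zero (F := F) hm
  have xx : ∀ m : M, x • x • m = p • z • m := fun m => by rw [smul_smul, h.xx, smul_assoc]
  have xy : ∀ m : M, x • y • m = q • z • m := fun m => by rw [smul_smul, h.xy, smul_assoc]
  have yx : ∀ m : M, y • x • m = q • z • m := fun m => by rw [smul_smul, h.yx, smul_assoc]
  have yy : ∀ m : M, y • y • m = p • z • m := fun m => by rw [smul_smul, h.yy, smul_assoc]
  have xz : ∀ m : M, x • z • m = 0 := by simp [smul_smul, h.xz]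
  have zx : ∀ m : M, z • x • m = 0 := by simp [smul_smul, h.zx]
  have yz : ∀ m : M, y • z • m = 0 := by simp [smul_smul, h.yz]
  have zy : ∀ m : M, z • y • m = 0 := by simp [smul_smul, h.zy]
  have zz : ∀ m : M, z • z • m = 0 := by simp [smul_smul, h.zz]
  refine hi.hasMatrices_of_frame h.adjoin_eq_top ![m, x • m, y • m, z • m]
    ![φ ∘ₗ Algebra.lsmul F F M z, φ ∘ₗ Algebra.lsmul F F M x, φ ∘ₗ Algebra.lsmul F F M y, φ]
    ?_ _ _ _ ?_ ?_ ?_ ?_ ?_ ?_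
  · -- the matrix is block triangular with determinant `φ (z m) ^ 4 (p² - q²)`
    have : (p * φ (z • m)) * (p * φ (z • m)) - (q * φ (z • m)) * (q * φ (z • m)) ≠ 0 := by
      have := mul_ne_zero (mul_ne_zero hφ hφ) h.nondegenerate
      intro h0
      apply this
      linear_combination h0
    rw [Matrix.det_succ_row_zero]
    simp [Fin.sum_univ_succ, Matrix.det_fin_three, Fin.succAbove, xx, xy, yx, yy, xz, zx, yz, zy,
      zz, hφ]
    rw [← sub_mul]
    exact mul_ne_zero this hφ
  all_goals simp +contextual [Fin.forall_fin_succ, Fin.sum_univ_succ, xx, xy, yx, yy, xz, zx, yz,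
    zy, zz]

variable (x y z M) in
/-- The module `M` is the one attached to the pencil `(α, β)`: it is `V × W`, where `x` and `y` map
`V` to `W` by `α` and `β`, and all three elements kill `W`. -/
def HasPencil {V W : Type*} [AddCommGroup V] [Module F V] [AddCommGroup W] [Module F W]
    (α β : V →ₗ[F] W) : Prop :=
  ∃ e : M ≃ₗ[F] V × W, ∀ m,
    e (x • m) = (0, α (e m).1) ∧ e (y • m) = (0, β (e m).1) ∧ z • m = 0

theorem IsLocalSymmetric.exists_hasPencil (h : IsLocalSymmetric x y z p q)
    (hz : ∀ m : M, z • m = 0) :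
    ∃ (V W : Submodule F M) (α β : V →ₗ[F] W), HasPencil x y z M α β := by
  let X : M →ₗ[F] M := Algebra.lsmul F F M x
  let Y : M →ₗ[F] M := Algebra.lsmul F F M y
  let W := LinearMap.range X ⊔ LinearMap.range Y
  have hXW : ∀ m, X m ∈ W := fun m => Submodule.mem_sup_left ⟨m, rfl⟩
  have hYW : ∀ m, Y m ∈ W := fun m => Submodule.mem_sup_right ⟨m, rfl⟩
  have hW : ∀ w ∈ W, x • w = 0 ∧ y • w = 0 := by
    intro w hw
    obtain ⟨_, ⟨m, rfl⟩, _, ⟨n, rfl⟩, rfl⟩ := Submodule.mem_sup.1 hw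
    simp only [X, Y, Algebra.lsmul_coe, smul_add, smul_smul, h.xx, h.xy, h.yx, h.yy, smul_assoc,
      hz, smul_zero, add_zero, and_self]
  obtain ⟨V, hV⟩ := W.exists_isCompl
  let e := Submodule.prodEquivOfIsCompl V W hV.symm
  refine ⟨V, W, (X.codRestrict W hXW).domRestrict V, (Y.codRestrict W hYW).domRestrict V,
    e.symm, fun m => ?_⟩
  obtain ⟨⟨v, w⟩, rfl⟩ := e.surjective m
  have he : e (v, w) = (v : M) + w := by simp [e]
  refine ⟨?_, ?_, hz _⟩
  · rw [LinearEquiv.symm_apply_eq, LinearEquiv.symm_apply_apply, he, smul_add, (hW w w.2).1]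
    simp [e, X]
  · rw [LinearEquiv.symm_apply_eq, LinearEquiv.symm_apply_apply, he, smul_add, (hW w w.2).2]
    simp [e, Y]

variable {V W : Type*} [AddCommGroup V] [Module F V] [AddCommGroup W] [Module F W]
    {α β : V →ₗ[F] W}

theorem HasPencil.isIndecomposable (hp : HasPencil x y z M α β) (hi : IsIndecomposableModule A M)
    (hgen : Algebra.adjoin F {x, y, z} = ⊤) : LinearPencil.IsIndecomposable α β := by
  obtain ⟨e, he⟩ := hp
  have := hi.1
  have hn : Nontrivial (V × W) := e.injective.nontrivial
  refine ⟨?_, fun P Q P' Q' c c' pa pb qa qb => ?_⟩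
  · by_contra! hs
    obtain ⟨_, _⟩ := hs
    exact false_of_nontrivial_of_subsingleton (V × W)
  have key : ∀ {R : Submodule F V} {R' : Submodule F W}, R ≤ R'.comap α → R ≤ R'.comap β →
      (∀ m ∈ (R.prod R').comap (e : M →ₗ[F] V × W),
        x • m ∈ (R.prod R').comap (e : M →ₗ[F] V × W)) ∧
      (∀ m ∈ (R.prod R').comap (e : M →ₗ[F] V × W),
        y • m ∈ (R.prod R').comap (e : M →ₗ[F] V × W)) ∧
      ∀ m ∈ (R.prod R').comap (e : M →ₗ[F] V × W),
        z • m ∈ (R.prod R').comap (e : M →ₗ[F] V × W) := by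
    intro R R' ha hb
    refine ⟨fun m hm => ?_, fun m hm => ?_, fun m hm => ?_⟩
    · simp only [Submodule.mem_comap, LinearEquiv.coe_coe, (he m).1, Submodule.mem_prod] at hm ⊢
      exact ⟨zero_mem _, ha hm.1⟩
    · simp only [Submodule.mem_comap, LinearEquiv.coe_coe, (he m).2.1, Submodule.mem_prod] at hm ⊢
      exact ⟨zero_mem _, hb hm.1⟩
    · rw [(he m).2.2]
      exact zero_mem _
  obtain ⟨p1, p2, p3⟩ := key pa pb
  obtain ⟨q1, q2, q3⟩ := key qa qb
  exact (hi.eq_bot_or_eq_bot hgen (isCompl_comap_equiv e (Submodule.isCompl_prod c c'))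
    p1 p2 p3 q1 q2 q3).imp
    (fun hh => (Submodule.prod_eq_bot_iff _ _ _).1 (eq_bot_of_comap_equiv e hh))
    (fun hh => (Submodule.prod_eq_bot_iff _ _ _).1 (eq_bot_of_comap_equiv e hh))

theorem HasPencil.nonempty_linearEquiv (hgen : Algebra.adjoin F {x, y, z} = ⊤) {N : Type*}
    [AddCommGroup N] [Module A N] [Module F N] [IsScalarTower F A N]
    (hM : HasPencil x y z M α β) (hN : HasPencil x y z N α β) : Nonempty (M ≃ₗ[A] N) := by
  obtain ⟨e, he⟩ := hM
  obtain ⟨e', he'⟩ := hN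
  refine nonempty_linearEquiv_of_adjoin hgen (e.trans e'.symm).toAddEquiv ?_ ?_ ?_ ?_
  · intro c m
    simp only [algebraMap_smul]
    exact (e.trans e'.symm).map_smul c m
  all_goals
    intro m
    refine e'.injective ?_
    have h := he m
    have h' := he' (e'.symm (e m))
    simp_all

end Local

theorem HasPencil.of_equivalent {F : Type u} [Field F] {A : Type v} [Ring A] {x y z : A}
    {M V W : Type*} [AddCommGroup M] [Module A M] [Module F M] [AddCommGroup V] [Module F V]
    [AddCommGroup W] [Module F W] {α β : V →ₗ[F] W} {V' W' : Type*}
    [AddCommGroup V'] [Module F V'] [AddCommGroup W']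
    [Module F W'] {α' β' : V' →ₗ[F] W'} (hp : HasPencil x y z M α β)
    (h : LinearPencil.Equivalent α β α' β') : HasPencil x y z M α' β' := by
  obtain ⟨e, he⟩ := hp
  obtain ⟨g, h, h1, h2⟩ := h
  refine ⟨e.trans (g.prodCongr h), fun m => ⟨?_, ?_, (he m).2.2⟩⟩
  · simp [(he m).1, h1]
  · simp [(he m).2.1, h2]

/-! ### One-parameter families and tameness -/

section Family

variable {F : Type u} [Field F] {A : Type v} [Ring A] [Algebra F A] {x y z : A} {p q : F}

/-- The bimodule over `A` and `F[T]` given by a representation of `A` on the free `F[T]`-module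
`F[T]^k × F[T]^k`. -/
noncomputable def OneParameterFamily.ofAlgHom {k : ℕ}
    (Φ : A →ₐ[F] Module.End F[X] ((Fin k → F[X]) × (Fin k → F[X]))) : OneParameterFamily F A :=
  letI : Module A ((Fin k → F[X]) × (Fin k → F[X])) := Module.compHom _ Φ.toRingHom
  { carrier := (Fin k → F[X]) × (Fin k → F[X])
    smulComm := ⟨fun f a m => ((Φ a).map_smul f m).symm⟩
    central := fun c m => by
      change Φ (algebraMap F A c) m = _
      rw [AlgHom.commutes, Module.algebraMap_end_apply]
      ext i <;> simp [Polynomial.smul_eq_C_mul] }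

/-- The map `(v, w) ↦ (0, γ v)` of `V × W`, for `γ : V → W`. -/
def nilpotentEnd {R V W : Type*} [CommRing R] [AddCommGroup V] [Module R V] [AddCommGroup W]
    [Module R W] (γ : V →ₗ[R] W) : Module.End R (V × W) :=
  LinearMap.inr R V W ∘ₗ γ ∘ₗ LinearMap.fst R V W

theorem nilpotentEnd_mul {R V W : Type*} [CommRing R] [AddCommGroup V] [Module R V]
    [AddCommGroup W] [Module R W] (γ δ : V →ₗ[R] W) : nilpotentEnd γ * nilpotentEnd δ = 0 := by
  ext <;> simp [nilpotentEnd]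

section Fiber

open Polynomial

variable {k : ℕ}

/-- Evaluation of pairs of vectors of polynomials at `c`. -/
noncomputable def evalPair (c : F) :
    (Fin k → F[X]) × (Fin k → F[X]) →+ (Fin k → F) × (Fin k → F) where
  toFun m := (fun i => (m.1 i).eval c, fun i => (m.2 i).eval c)
  map_zero' := by ext <;> simp
  map_add' m n := by ext <;> simp

/-- Pairs of vectors as pairs of vectors of constant polynomials. -/
noncomputable def constPair :
    (Fin k → F) × (Fin k → F) →+ (Fin k → F[X]) × (Fin k → F[X]) where
  toFun m := (fun i => C (m.1 i), fun i => C (m.2 i))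
  map_zero' := by ext <;> simp
  map_add' m n := by ext <;> simp

theorem evalPair_smul (c : F) (r : F[X]) (m : (Fin k → F[X]) × (Fin k → F[X])) :
    evalPair c (r • m) = r.eval c • evalPair c m := by
  ext <;> simp [evalPair]

theorem evalPair_constPair (c : F) (m : (Fin k → F) × (Fin k → F)) :
    evalPair c (constPair m) = m := by
  ext <;> simp [evalPair, constPair]

theorem eq_constPair_evalPair_add (c : F) (m : (Fin k → F[X]) × (Fin k → F[X])) :
    ∃ n, m = constPair (evalPair c m) + (X - C c) • n := by
  refine ⟨(fun i => m.1 i /ₘ (X - C c), fun i => m.2 i /ₘ (X - C c)), ?_⟩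
  ext1 <;> funext i
  · have := modByMonic_add_div (m.1 i) (X - C c)
    rw [modByMonic_X_sub_C_eq_C_eval] at this
    exact this.symm
  · have := modByMonic_add_div (m.2 i) (X - C c)
    rw [modByMonic_X_sub_C_eq_C_eval] at this
    exact this.symm

/-- Evaluation at `c` on the fiber at `c`. -/
noncomputable def fiberEval (c : F) :
    ((Fin k → F[X]) × (Fin k → F[X])) ⊗[F[X]] (F[X] ⧸ Ideal.span {(X - C c : F[X])}) →+
      (Fin k → F) × (Fin k → F) :=
  TensorProduct.liftAddHom
    (AddMonoidHom.mk' (fun m => AddMonoidHom.mk'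
      (fun r => quotientSpanXSubCAlgEquiv c r • evalPair c m)
      (fun r s => by rw [map_add, add_smul]))
      (fun m n => by ext <;> simp))
    (fun r m s => by
      obtain ⟨s, rfl⟩ := Ideal.Quotient.mk_surjective s
      change quotientSpanXSubCAlgEquiv c (Ideal.Quotient.mk _ s) • evalPair c (r • m) =
        quotientSpanXSubCAlgEquiv c (Ideal.Quotient.mk _ (r * s)) • evalPair c m
      rw [quotientSpanXSubCAlgEquiv_mk, quotientSpanXSubCAlgEquiv_mk, evalPair_smul, smul_smul,
        eval_mul, mul_comm])

theorem fiberEval_tmul_one (c : F) (m : (Fin k → F[X]) × (Fin k → F[X])) :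
    fiberEval c (m ⊗ₜ 1) = evalPair c m := by
  change quotientSpanXSubCAlgEquiv c 1 • evalPair c m = _
  rw [map_one, one_smul]

theorem smul_one_quotient (I : Ideal F[X]) (r : F[X]) :
    r • (1 : F[X] ⧸ I) = Ideal.Quotient.mk I r := by
  change Ideal.Quotient.mk I (r * 1) = _
  rw [mul_one]

theorem tmul_one_eq (c : F) (m : (Fin k → F[X]) × (Fin k → F[X])) :
    m ⊗ₜ[F[X]] (1 : F[X] ⧸ Ideal.span {(X - C c : F[X])}) =
      constPair (evalPair c m) ⊗ₜ[F[X]] (1 : F[X] ⧸ Ideal.span {(X - C c : F[X])}) := by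
  obtain ⟨n, hn⟩ := eq_constPair_evalPair_add c m
  have h2 : (X - C c) • (1 : F[X] ⧸ Ideal.span {(X - C c : F[X])}) = 0 := by
    rw [smul_one_quotient]
    exact Ideal.Quotient.eq_zero_iff_mem.2 (Ideal.mem_span_singleton_self _)
  conv_lhs => rw [hn]
  rw [TensorProduct.add_tmul, TensorProduct.smul_tmul, h2, TensorProduct.tmul_zero, add_zero]

theorem exists_eq_tmul_one (c : F)
    (t : ((Fin k → F[X]) × (Fin k → F[X])) ⊗[F[X]] (F[X] ⧸ Ideal.span {(X - C c : F[X])})) :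
    ∃ m, t = m ⊗ₜ 1 := by
  induction t using TensorProduct.induction_on with
  | zero => exact ⟨0, (TensorProduct.zero_tmul _ _).symm⟩
  | add s t hs ht =>
    obtain ⟨m, rfl⟩ := hs
    obtain ⟨n, rfl⟩ := ht
    exact ⟨m + n, (TensorProduct.add_tmul _ _ _).symm⟩
  | tmul m s =>
    obtain ⟨s, rfl⟩ := Ideal.Quotient.mk_surjective s
    refine ⟨s • m, ?_⟩
    rw [TensorProduct.smul_tmul, smul_one_quotient]

/-- The fiber at `c` is obtained by evaluating polynomials at `c`. -/
noncomputable def fiberEquiv (c : F) : (Fin k → F) × (Fin k → F) ≃+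
    ((Fin k → F[X]) × (Fin k → F[X])) ⊗[F[X]] (F[X] ⧸ Ideal.span {(X - C c : F[X])}) where
  toFun m := constPair m ⊗ₜ 1
  map_add' m n := by rw [map_add, TensorProduct.add_tmul]
  invFun := fiberEval c
  left_inv m := by rw [fiberEval_tmul_one, evalPair_constPair]
  right_inv t := by
    obtain ⟨m, rfl⟩ := exists_eq_tmul_one c t
    rw [fiberEval_tmul_one]
    exact (tmul_one_eq c m).symm

theorem tmul_one_eq_fiberEquiv (c : F) (m : (Fin k → F[X]) × (Fin k → F[X])) :
    m ⊗ₜ[F[X]] (1 : F[X] ⧸ Ideal.span {(X - C c : F[X])}) = fiberEquiv c (evalPair c m) :=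
  tmul_one_eq c m

end Fiber

open Polynomial Matrix in
/-- Every one-parameter family of pencils `(B, A₀ + T B)` of square matrices is realized by a
one-parameter family of modules. -/
theorem IsLocalSymmetric.exists_family (h : IsLocalSymmetric x y z p q) {k : ℕ}
    (A₀ B : Matrix (Fin k) (Fin k) F) :
    ∃ 𝓜 : OneParameterFamily F A, ∀ (c : F) (M : Type u) [AddCommGroup M] [Module A M]
      [Module F M] [IsScalarTower F A M],
      HasPencil x y z M B.mulVecLin (A₀.mulVecLin + c • B.mulVecLin) →
      Nonempty (M ≃ₗ[A] 𝓜.fiber c) := by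
  obtain ⟨Φ, hx, hy, hz⟩ := h.exists_algHom
    (nilpotentEnd_mul (B.map C).mulVecLin (B.map C).mulVecLin)
    (nilpotentEnd_mul _ ((A₀.map C).mulVecLin + (X : F[X]) • (B.map C).mulVecLin))
    (nilpotentEnd_mul _ _) (nilpotentEnd_mul _ _)
  refine ⟨OneParameterFamily.ofAlgHom Φ, fun c M _ _ _ _ hM => ?_⟩
  obtain ⟨e, he⟩ := hM
  have hact : ∀ (a : A) (m : (Fin k → F) × (Fin k → F)),
      a • (show (OneParameterFamily.ofAlgHom Φ).fiber c from fiberEquiv c m) =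
        (show (OneParameterFamily.ofAlgHom Φ).fiber c from
          fiberEquiv c (evalPair c (Φ a (constPair m)))) := by
    intro a m
    exact tmul_one_eq_fiberEquiv c (Φ a (constPair m))
  have hmv : ∀ (N : Matrix (Fin k) (Fin k) F) (v : Fin k → F) (i : Fin k),
      (((N.map C) *ᵥ fun j => C (v j)) i).eval c = (N *ᵥ v) i := by
    intro N v i
    simp [Matrix.mulVec, dotProduct, eval_finsetSum]
  refine nonempty_linearEquiv_of_adjoin h.adjoin_eq_top
    (e.toAddEquiv.trans (fiberEquiv c)) ?_ ?_ ?_ ?_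
  · intro a m
    refine Eq.trans ?_ (hact (algebraMap F A a) (e m)).symm
    refine congrArg (fiberEquiv c) ?_
    rw [AlgHom.commutes, Module.algebraMap_end_apply, algebraMap_smul]
    ext <;> simp [evalPair, constPair]
  · intro m
    refine Eq.trans ?_ (hact x (e m)).symm
    refine congrArg (fiberEquiv c) ?_
    rw [hx]
    refine (he m).1.trans ?_
    ext i <;> simp [evalPair, constPair, nilpotentEnd, hmv]
  · intro m
    refine Eq.trans ?_ (hact y (e m)).symm
    refine congrArg (fiberEquiv c) ?_
    rw [hy]
    refine (he m).2.1.trans ?_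
    ext i <;> simp [evalPair, constPair, nilpotentEnd, hmv]
  · intro m
    refine Eq.trans ?_ (hact z (e m)).symm
    refine congrArg (fiberEquiv c) ?_
    rw [hz]
    change e (z • m) = _
    rw [(he m).2.2]
    ext i <;> simp [evalPair]

end Family

/-! ### The representation type of local symmetric algebras -/

section InfiniteType

variable {F : Type u} [Field F] {A : Type v} [Ring A] [Algebra F A] {x y z : A} {p q : F}

/-- For each `c`, the algebra has a two-dimensional uniserial module on which `x ≠ 0` and
`y = c x`. -/
theorem IsLocalSymmetric.exists_uniserial (h : IsLocalSymmetric x y z p q) (c : F) :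
    ∃ N : ModuleCat.{u} A, Module.Finite F (RestrictScalars F A N) ∧
      IsIndecomposableModule A N ∧ (∀ m : N, y • m = algebraMap F A c • x • m) ∧
      ∃ m : N, x • m ≠ 0 := by
  obtain ⟨Φ, hx, hy, -⟩ := h.exists_algHom
    (nilpotentEnd_mul (LinearMap.id : F →ₗ[F] F) LinearMap.id)
    (nilpotentEnd_mul _ (c • LinearMap.id)) (nilpotentEnd_mul _ _) (nilpotentEnd_mul _ _)
  let inst : Module A (F × F) := Module.compHom (F × F) Φ.toRingHom
  have hact : ∀ (a : A) (m : F × F), a • m = Φ a m := fun a m => rfl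
  have hc : ∀ (a : F) (m : F × F), algebraMap F A a • m = a • m := fun a m => by
    rw [hact, AlgHom.commutes, Module.algebraMap_end_apply]
  have hxm : ∀ m : F × F, x • m = (0, m.1) := fun m => by rw [hact, hx]; simp [nilpotentEnd]
  have hym : ∀ m : F × F, y • m = (0, c * m.1) := fun m => by rw [hact, hy]; simp [nilpotentEnd]
  have htop : ∀ (P : Submodule A (F × F)) (m : F × F), m ∈ P → m.1 ≠ 0 → P = ⊤ := by
    intro P m hm h0
    rw [eq_top_iff]
    intro n _
    have : n = algebraMap F A (n.1 / m.1) • m +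
        algebraMap F A ((n.2 - n.1 / m.1 * m.2) / m.1) • x • m := by
      rw [hc, hc, hxm]
      ext <;> simp [h0]
    rw [this]
    exact P.add_mem (P.smul_mem _ hm) (P.smul_mem _ (P.smul_mem _ hm))
  refine ⟨ModuleCat.of A (F × F), ?_, ⟨inferInstanceAs (Nontrivial (F × F)), ?_⟩, ?_, ?_⟩
  · let L : (F × F) →ₗ[F] RestrictScalars F A (F × F) :=
      { toFun := fun m => m
        map_add' := fun _ _ => rfl
        map_smul' := fun a m => (hc a m).symm }
    exact Module.Finite.of_surjective L fun m => ⟨m, rfl⟩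
  · change ∀ P Q : Submodule A (F × F), IsCompl P Q → P = ⊥ ∨ Q = ⊥
    intro P Q hPQ
    by_cases hP : ∃ m ∈ P, (m : F × F).1 ≠ 0
    · obtain ⟨m, hm, h0⟩ := hP
      rw [htop P m hm h0] at hPQ
      exact Or.inr (by simpa using hPQ.inf_eq_bot)
    by_cases hQ : ∃ m ∈ Q, (m : F × F).1 ≠ 0
    · obtain ⟨m, hm, h0⟩ := hQ
      rw [htop Q m hm h0] at hPQ
      exact Or.inl (by simpa using hPQ.inf_eq_bot)
    push Not at hP hQ
    have : ((1, 0) : F × F) ∈ P ⊔ Q := by rw [hPQ.sup_eq_top]; trivial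
    obtain ⟨a, ha, b, hb, hab⟩ := Submodule.mem_sup.1 this
    have := congrArg Prod.fst hab
    simp [hP a ha, hQ b hb] at this
  · intro m
    change y • (show F × F from m) = algebraMap F A c • x • (show F × F from m)
    rw [hym, hc, hxm]
    simp
  · refine ⟨(show F × F from (1, 0)), ?_⟩
    change x • ((1, 0) : F × F) ≠ 0
    rw [hxm]
    simp

theorem IsLocalSymmetric.not_hasFiniteRepType [Infinite F] (h : IsLocalSymmetric x y z p q) :
    ¬ HasFiniteRepType F A := by
  rintro ⟨S, hS, hcov⟩
  choose N hfin hind hN m hm using h.exists_uniserial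
  choose f hfS hf using fun c => hcov (N c) (hfin c) (hind c)
  have := hS.to_subtype
  obtain ⟨c, d, hcd, hfcd⟩ := Finite.exists_ne_map_eq_of_infinite fun c => (⟨f c, hfS c⟩ : S)
  have hfcd' : f c = f d := congrArg Subtype.val hfcd
  obtain ⟨e⟩ := hf c
  rw [hfcd'] at e
  obtain ⟨e'⟩ := hf d
  let g := e'.trans e.symm
  -- on the module with parameter `d`, the element `y` acts both as `d x` and as `c x`
  have h1 : y • m d = algebraMap F A c • x • m d := by
    refine g.injective ?_
    rw [map_smul, hN, map_smul, map_smul]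
  rw [hN, ← sub_eq_zero, ← sub_smul, ← map_sub] at h1
  apply hm d
  have h2 : algebraMap F A (d - c)⁻¹ • algebraMap F A (d - c) • x • m d = 0 := by
    rw [h1, smul_zero]
  rwa [smul_smul, ← map_mul, inv_mul_cancel₀ (sub_ne_zero.2 hcd.symm), map_one, one_smul] at h2

end InfiniteType

section Tame

open Module LinearPencil

variable {F : Type u} [Field F] {A : Type v} [Ring A] [Algebra F A] {x y z : A} {p q : F}

theorem LinearPencil.exists_equivalent_mulVecLin {V W : Type*} [AddCommGroup V] [Module F V]
    [AddCommGroup W] [Module F W] [FiniteDimensional F V] [FiniteDimensional F W]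
    (α β : V →ₗ[F] W) {k : ℕ} (hV : finrank F V = k) (hW : finrank F W = k) :
    ∃ A₀ B : Matrix (Fin k) (Fin k) F, Equivalent α β A₀.mulVecLin B.mulVecLin := by
  let g : V ≃ₗ[F] (Fin k → F) := LinearEquiv.ofFinrankEq _ _ (by simpa using hV)
  let h : W ≃ₗ[F] (Fin k → F) := LinearEquiv.ofFinrankEq _ _ (by simpa using hW)
  refine ⟨LinearMap.toMatrix' (h ∘ₗ α ∘ₗ g.symm), LinearMap.toMatrix' (h ∘ₗ β ∘ₗ g.symm), g, h,
    fun v => ?_, fun v => ?_⟩ <;>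
  · rw [← Matrix.toLin'_apply', Matrix.toLin'_toMatrix']
    simp

/-- The indecomposable modules not covered by a one-parameter family fall into finitely many
isomorphism classes, labelled by the kind of the module (free, or given by a pencil whose first map
is not surjective, or not injective) and the dimension of the source of the pencil. -/
def IsDiscreteModule (x y z : A) (p q : F) (d : ℕ) (c : Fin 3 × Fin (d + 1)) (M : Type u)
    [AddCommGroup M] [Module A M] [Module F M] : Prop :=
  (c.1 = 0 ∧ HasMatrices x y z M !![0, 0, 0, 0; 1, 0, 0, 0; 0, 0, 0, 0; 0, p, q, 0]
      !![0, 0, 0, 0; 0, 0, 0, 0; 1, 0, 0, 0; 0, q, p, 0]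
      !![0, 0, 0, 0; 0, 0, 0, 0; 0, 0, 0, 0; 1, 0, 0, 0]) ∨
  ∃ (V W : Submodule F M) (α β : V →ₗ[F] W), FiniteDimensional F V ∧ FiniteDimensional F W ∧
    HasPencil x y z M α β ∧ LinearPencil.IsIndecomposable α β ∧ finrank F V = c.2 ∧
    finrank F W = d - c.2 ∧ ((c.1 = 1 ∧ ¬ Function.Surjective α) ∨
      (c.1 = 2 ∧ ¬ Function.Injective α))

theorem IsDiscreteModule.nonempty_linearEquiv (h : IsLocalSymmetric x y z p q) {d : ℕ}
    {c : Fin 3 × Fin (d + 1)} {M N : Type u} [AddCommGroup M] [Module A M] [Module F M]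
    [IsScalarTower F A M] [AddCommGroup N] [Module A N] [Module F N] [IsScalarTower F A N]
    (hM : IsDiscreteModule x y z p q d c M) (hN : IsDiscreteModule x y z p q d c N) :
    Nonempty (M ≃ₗ[A] N) := by
  have hgen := h.adjoin_eq_top
  rcases hM with ⟨h0, hM⟩ | ⟨V, W, α, β, _, _, hM, hi, hV, hW, hs⟩
  · rcases hN with ⟨-, hN⟩ | ⟨V', W', α', β', _, _, hN, hi', hV', hW', hs'⟩
    · exact hM.nonempty_linearEquiv hgen hN
    · simp [h0] at hs'
  · rcases hN with ⟨h0, -⟩ | ⟨V', W', α', β', _, _, hN, hi', hV', hW', hs'⟩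
    · simp [h0] at hs
    · refine (hM.of_equivalent ?_).nonempty_linearEquiv hgen hN
      rcases hs with ⟨h1, hs⟩ | ⟨h1, hs⟩ <;> rcases hs' with ⟨h1', hs'⟩ | ⟨h1', hs'⟩
      · exact (IsIndecomposable.equivalent_of_not_surjective _ hi hs hW).2 hi' hs'
          (hV'.trans hV.symm) hW'
      · simp [h1] at h1'
      · simp [h1] at h1'
      · exact hi.equivalent_of_not_injective hs hi' hs' (hV'.trans hV.symm) (hW'.trans hW.symm)

theorem IsLocalSymmetric.hasTameRepType [IsAlgClosed F] (h : IsLocalSymmetric x y z p q) :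
    HasTameRepType F A := by
  have : Infinite F := IsAlgClosed.instInfinite
  refine ⟨h.not_hasFiniteRepType, fun d hd => ?_⟩
  let inst (N : ModuleCat.{u} A) : Module F N := Module.restrictScalars F A N
  have tower (N : ModuleCat.{u} A) : IsScalarTower F A N := IsScalarTower.restrictScalars F A N
  obtain ⟨S, hS, hcov⟩ := exists_finite_representatives
    (fun (c : Fin 3 × Fin (d + 1)) (N : ModuleCat.{u} A) => IsDiscreteModule x y z p q d c N)
    (fun N N' => Nonempty (N ≃ₗ[A] N')) (fun C N N' hN hN' => hN.nonempty_linearEquiv h hN')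
  -- the tube of homogeneous pencils: one indecomposable singular pencil `(A₀, B)` of size `d / 2`
  -- gives the family `(B, A₀ + T B)`
  obtain ⟨T, hT, hcovT⟩ : ∃ T : Set (OneParameterFamily F A), T.Finite ∧
      ∀ (M : Type u) [AddCommGroup M] [Module A M] [Module F M] [IsScalarTower F A M]
        (V W : Submodule F M) [FiniteDimensional F V] [FiniteDimensional F W] (α β : V →ₗ[F] W)
        (c : F), HasPencil x y z M α β → IsIndecomposable α β → finrank F V = d / 2 →
        finrank F W = d / 2 → ¬ Function.Surjective (β - c • α) →
        ∃ 𝓜 ∈ T, Nonempty (M ≃ₗ[A] 𝓜.fiber c) := by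
    by_cases hex : ∃ A₀ B : Matrix (Fin (d / 2)) (Fin (d / 2)) F,
        IsIndecomposable A₀.mulVecLin B.mulVecLin ∧ ¬ Function.Surjective A₀.mulVecLin
    · obtain ⟨A₀, B, hi₀, hs₀⟩ := hex
      obtain ⟨𝓜, h𝓜⟩ := h.exists_family A₀ B
      refine ⟨{𝓜}, Set.finite_singleton _, ?_⟩
      intro M _ _ _ _ V W _ _ α β c hM hi hV hW hs
      refine ⟨𝓜, rfl, h𝓜 c M (hM.of_equivalent ?_)⟩
      obtain ⟨g, h, h1, h2⟩ := (IsIndecomposable.equivalent_of_not_surjective _ (hi.sub_smul c) hs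
        hW).2 hi₀ hs₀ (by rw [finrank_fin_fun, hV]) (by rw [finrank_fin_fun])
      refine ⟨g, h, h2, fun v => ?_⟩
      have h3 := h1 v
      rw [LinearMap.sub_apply, map_sub, LinearMap.smul_apply, map_smul, h2, sub_eq_iff_eq_add] at h3
      exact h3
    · refine ⟨∅, Set.finite_empty, ?_⟩
      intro M _ _ _ _ V W _ _ α β c hM hi hV hW hs
      exfalso
      obtain ⟨A₀, B, hE⟩ := exists_equivalent_mulVecLin (β - c • α) α hV hW
      refine hex ⟨A₀, B, (hi.sub_smul c).of_equivalent hE, fun hs' => hs fun w => ?_⟩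
      obtain ⟨g, h, h1, -⟩ := hE
      obtain ⟨v, hv⟩ := hs' (h w)
      exact ⟨g.symm v, h.injective (by rw [h1, g.apply_symm_apply, hv])⟩
  refine ⟨S, T, hS, hT, fun N hN hi => ?_⟩
  replace hN : finrank F N = d := hN
  have : Module.Finite F N := Module.finite_of_finrank_pos (hN ▸ hd)
  by_cases hz : ∀ m : N, z • m = 0
  swap
  · exact Or.inl (hcov (0, 0) N (Or.inl ⟨rfl, h.hasMatrices hi hz⟩))
  obtain ⟨V, W, α, β, hp⟩ := h.exists_hasPencil hz
  have hip := hp.isIndecomposable hi h.adjoin_eq_top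
  have hdim : finrank F V + finrank F W = d := by
    obtain ⟨e, -⟩ := hp
    rw [← finrank_prod, ← e.finrank_eq, hN]
  by_cases hs : Function.Surjective α
  swap
  · exact Or.inl (hcov (1, ⟨finrank F V, by lia⟩) N (Or.inr ⟨V, W, α, β, inferInstance,
      inferInstance, hp, hip, rfl, by simp; lia, Or.inl ⟨rfl, hs⟩⟩))
  by_cases hs' : Function.Injective α
  swap
  · exact Or.inl (hcov (2, ⟨finrank F V, by lia⟩) N (Or.inr ⟨V, W, α, β, inferInstance,
      inferInstance, hp, hip, rfl, by simp; lia, Or.inr ⟨rfl, hs'⟩⟩))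
  have hVW := (LinearEquiv.ofBijective α ⟨hs', hs⟩).finrank_eq
  obtain ⟨c, hc⟩ := exists_not_surjective_sub_smul α β hVW (by lia) ⟨hs', hs⟩
  obtain ⟨𝓜, h𝓜, e⟩ := hcovT N V W α β c hp hip (by lia) (by lia) hc
  exact Or.inr ⟨𝓜, h𝓜, c, e⟩

end Tame

/-! ### Finite dihedral Coxeter groups -/

namespace CoxeterSystem

section Dihedral

variable {M : CoxeterMatrix (Fin 2)} {W : Type v} [Group W] (cs : CoxeterSystem M W)

/-- The product of the alternating word of length `k` in the reflections `i` and `j` that ends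
in `j`. -/
def alt (i j : Fin 2) (k : ℕ) : W := cs.wordProd (alternatingWord i j k)

@[simp] theorem alt_zero (i j : Fin 2) : cs.alt i j 0 = 1 := cs.wordProd_nil

theorem alt_succ (i j : Fin 2) (k : ℕ) : cs.alt i j (k + 1) = cs.alt j i k * cs.simple j := by
  rw [alt, alternatingWord_succ, wordProd_concat, alt]

theorem alt_one (i j : Fin 2) : cs.alt i j 1 = cs.simple j := by
  rw [alt_succ, alt_zero, one_mul]

theorem alt_eq (i j : Fin 2) (k : ℕ) : cs.alt i j k =
    (if Even k then 1 else cs.simple j) * (cs.simple i * cs.simple j) ^ (k / 2) :=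
  cs.prod_alternatingWord_eq_mul_pow i j k

theorem alt_add_two_mul (i j : Fin 2) (k m : ℕ) :
    cs.alt i j (k + 2 * m) = cs.alt i j k * cs.alt i j (2 * m) := by
  rw [alt_eq, alt_eq, alt_eq, mul_assoc]
  have h1 : (k + 2 * m) / 2 = k / 2 + m := by lia
  simp [Nat.even_add, h1, pow_add]

theorem simple_mul_alt_two_mul (i j : Fin 2) (l : ℕ) :
    cs.simple j * cs.alt i j (2 * l) = cs.alt i j (2 * l + 1) := by
  have h1 : (2 * l + 1) / 2 = l := by lia
  rw [alt_eq, alt_eq]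
  simp [h1]

theorem simple_mul_alt_two_mul_add_one (i j : Fin 2) (l : ℕ) :
    cs.simple i * cs.alt i j (2 * l + 1) = cs.alt i j (2 * l + 2) := by
  have h1 : (2 * l + 1) / 2 = l := by lia
  have h2 : (2 * l + 2) / 2 = l + 1 := by lia
  rw [alt_eq, alt_eq, h1, h2, pow_succ', mul_assoc]
  simp [Nat.even_add]

theorem alt_eq_alt_sub {i j : Fin 2} {n : ℕ} (hM : M i j = n) {k : ℕ} (hk : k ≤ 2 * n) :
    cs.alt i j k = cs.alt j i (2 * n - k) := by
  have := cs.prod_alternatingWord_eq_prod_alternatingWord_sub i j k (by rw [hM, mul_comm]; exact hk)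
  rwa [hM, mul_comm n 2] at this

theorem alt_two_mul_self {i j : Fin 2} {n : ℕ} (hM : M i j = n) : cs.alt i j (2 * n) = 1 := by
  rw [cs.alt_eq_alt_sub hM le_rfl, Nat.sub_self, alt_zero]

/-- The map to the dihedral group shows that the alternating products of length less than `2 n` are
distinct. -/
theorem alt_injective {i j : Fin 2} (hij : i ≠ j) {n : ℕ} (hM : M i j = n) {k l : ℕ}
    (hk : k < 2 * n) (hl : l < 2 * n) (h : cs.alt i j k = cs.alt i j l) : k = l := by
  let f : Fin 2 → DihedralGroup n := fun a => if a = i then .sr 0 else .sr 1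
  have hfi : f i = .sr 0 := by simp [f]
  have hfj : f j = .sr 1 := by simp [f, hij.symm]
  have hlift : M.IsLiftable f := by
    have h2 : ∀ a, a = i ∨ a = j := by omega
    intro a b
    rcases h2 a with rfl | rfl <;> rcases h2 b with rfl | rfl
    · simp [hfi]
    · simp [hfi, hfj, hM]
    · simp [hfi, hfj, M.symmetric a b, hM]
    · simp [hfj]
  have key : ∀ k, cs.lift ⟨f, hlift⟩ (cs.alt i j k) =
      if Even k then .r ((k / 2 : ℕ) : ZMod n) else .sr (1 + ((k / 2 : ℕ) : ZMod n)) := by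
    intro k
    rw [alt_eq, map_mul, map_pow, map_mul, lift_apply_simple, lift_apply_simple, hfi, hfj]
    split_ifs <;> simp [lift_apply_simple, hfj]
  have h' := congrArg (cs.lift ⟨f, hlift⟩) h
  rw [key, key] at h'
  have hcast : ∀ {a b : ℕ}, a < n → b < n → (a : ZMod n) = b → a = b := by
    intro a b ha hb hab
    rw [ZMod.natCast_eq_natCast_iff'] at hab
    rwa [Nat.mod_eq_of_lt ha, Nat.mod_eq_of_lt hb] at hab
  split_ifs at h' with hke hle hle
  · have := hcast (by lia) (by lia) (DihedralGroup.r.inj h')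
    have := Nat.even_iff.1 hke
    have := Nat.even_iff.1 hle
    lia
  · have := hcast (by lia) (by lia) (add_left_cancel (DihedralGroup.sr.inj h'))
    have := Nat.not_even_iff.1 hke
    have := Nat.not_even_iff.1 hle
    lia

theorem length_alt_le (i j : Fin 2) (k : ℕ) : cs.length (cs.alt i j k) ≤ k := by
  simpa [alt] using cs.length_wordProd_le (alternatingWord i j k)

/-- Every element is an alternating product, of length equal to its Coxeter length. -/
theorem exists_eq_alt (k : ℕ) :
    ∀ w : W, cs.length w = k → ∃ i j : Fin 2, i ≠ j ∧ w = cs.alt i j k := by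
  induction k with
  | zero =>
    intro w hw
    exact ⟨0, 1, by simp, by rw [alt_zero, ← cs.length_eq_zero_iff, hw]⟩
  | succ k ih =>
    intro w hw
    obtain ⟨a, ha⟩ := cs.exists_rightDescent_of_ne_one (w := w)
      (by rintro rfl; simp at hw)
    have hwa : cs.length (w * cs.simple a) = k := by
      have := cs.isRightDescent_iff.1 ha
      lia
    have hwa' : w = w * cs.simple a * cs.simple a := by simp
    obtain ⟨i, j, hij, h⟩ := ih _ hwa
    rw [h] at hwa'
    by_cases hja : j = a
    · subst hja
      cases k with
      | zero =>
        refine ⟨i, j, hij, ?_⟩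
        rw [alt_one]
        simpa using hwa'
      | succ k =>
        rw [alt_succ, simple_mul_simple_cancel_right] at hwa'
        have := cs.length_alt_le j i k
        rw [← hwa'] at this
        lia
    · refine ⟨j, a, hja, ?_⟩
      have hia : i = a := by omega
      rw [alt_succ, hwa', hia]

theorem exists_eq_alt_or {i j : Fin 2} (hij : i ≠ j) (w : W) :
    w = cs.alt i j (cs.length w) ∨ w = cs.alt j i (cs.length w) := by
  obtain ⟨a, b, hab, h⟩ := cs.exists_eq_alt _ w rfl
  by_cases ha : a = i
  · have hb : b = j := by omega
    subst ha hb
    exact Or.inl h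
  · have ha' : a = j := by omega
    have hb : b = i := by omega
    subst ha' hb
    exact Or.inr h

theorem length_le {i j : Fin 2} (hij : i ≠ j) {n : ℕ} (hn : 0 < n) (hM : M i j = n) (w : W) :
    cs.length w ≤ n := by
  by_contra! hlt
  have hred : ∀ a b : Fin 2, M a b = n → w ≠ cs.alt a b (cs.length w) := by
    intro a b hab h
    refine cs.not_isReduced_alternatingWord a b (m := cs.length w) (by rw [hab]; lia)
      (by rw [hab]; exact hlt) ?_
    rw [IsReduced, length_alternatingWord]
    exact congrArg cs.length h.symm
  rcases cs.exists_eq_alt_or hij w with h | h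
  · exact hred i j hM h
  · exact hred j i (by rw [M.symmetric, hM]) h

theorem length_alt {i j : Fin 2} (hij : i ≠ j) {n : ℕ} (hn : 0 < n) (hM : M i j = n) {k : ℕ}
    (hk : k ≤ n) : cs.length (cs.alt i j k) = k := by
  have hle := cs.length_alt_le i j k
  rcases cs.exists_eq_alt_or hij (cs.alt i j k) with h | h
  · exact (cs.alt_injective hij hM (by lia) (by lia) h).symm
  · rcases Nat.eq_zero_or_pos (cs.length (cs.alt i j k)) with h0 | hpos
    · rw [h0]
      rw [cs.length_eq_zero_iff] at h0
      exact (cs.alt_injective hij hM (by lia) (by lia) (h0.trans (cs.alt_zero i j).symm)).symm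
    · rw [cs.alt_eq_alt_sub ((M.symmetric j i).trans hM) (by lia)] at h
      have := cs.alt_injective hij hM (by lia) (by lia) h
      lia

theorem mem_minCosetReps_singleton {i j : Fin 2} (hij : i ≠ j) {n : ℕ} (hn : 0 < n)
    (hM : M i j = n) (w : W) : w ∈ cs.minCosetReps {i} ↔ ∃ k < n, w = cs.alt i j k := by
  have hM' : M j i = n := (M.symmetric j i).trans hM
  simp only [minCosetReps, Set.mem_singleton_iff, forall_eq, Set.mem_ofPred_eq]
  constructor
  · intro h
    have hdesc : ∀ k, k + 1 = cs.length w → w ≠ cs.alt j i (k + 1) := by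
      intro k hkw hk
      have h1 : w * cs.simple i = cs.alt i j k := by
        rw [hk, alt_succ, simple_mul_simple_cancel_right]
      have := cs.length_alt_le i j k
      rw [h1] at h
      lia
    have hle := cs.length_le hij hn hM w
    rcases cs.exists_eq_alt_or hij w with hw | hw
    · rcases hle.lt_or_eq with hlt | heq
      · exact ⟨_, hlt, hw⟩
      · -- the longest element also ends in `i`
        rw [heq, cs.alt_eq_alt_sub hM (by lia), two_mul, Nat.add_sub_cancel] at hw
        obtain ⟨m, rfl⟩ : ∃ m, n = m + 1 := ⟨n - 1, by lia⟩
        exact absurd hw (hdesc m heq.symm)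
    · rcases Nat.eq_zero_or_pos (cs.length w) with h0 | hpos
      · exact ⟨0, hn, by rw [alt_zero, ← cs.length_eq_zero_iff, h0]⟩
      · obtain ⟨m, hm⟩ : ∃ m, cs.length w = m + 1 := ⟨cs.length w - 1, by lia⟩
        rw [hm] at hw
        exact absurd hw (hdesc m hm.symm)
  · rintro ⟨k, hk, rfl⟩
    rw [← alt_succ, cs.length_alt hij hn hM hk.le, cs.length_alt hij.symm hn hM' hk]
    exact k.lt_succ_self

theorem exists_lt_two_mul_eq_alt {i j : Fin 2} (hij : i ≠ j) {n : ℕ} (hn : 0 < n)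
    (hM : M i j = n) (w : W) : ∃ k < 2 * n, w = cs.alt i j k := by
  have hle := cs.length_le hij hn hM w
  rcases cs.exists_eq_alt_or hij w with hw | hw
  · exact ⟨_, by lia, hw⟩
  · rcases Nat.eq_zero_or_pos (cs.length w) with h0 | hpos
    · exact ⟨0, by lia, by rw [alt_zero, ← cs.length_eq_zero_iff, h0]⟩
    · rw [cs.alt_eq_alt_sub ((M.symmetric j i).trans hM) (by lia)] at hw
      exact ⟨_, by lia, hw⟩

theorem minCosetReps_empty : cs.minCosetReps ∅ = Set.univ := by
  simp [minCosetReps]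

theorem minCosetReps_univ : cs.minCosetReps Set.univ = {1} := by
  ext w
  simp only [minCosetReps, Set.mem_univ, true_imp_iff, Set.mem_ofPred_eq, Set.mem_singleton_iff]
  constructor
  · intro h
    by_contra hw
    obtain ⟨i, hi⟩ := cs.exists_rightDescent_of_ne_one hw
    exact absurd (h i) hi.not_gt
  · rintro rfl i
    simp

end Dihedral

section DescentElements

variable {M : CoxeterMatrix (Fin 2)} {W : Type v} [Group W] [Fintype W] (cs : CoxeterSystem M W)
  (F : Type u) [Field F]

open MonoidAlgebra

open Classical in
theorem coeff_descentElement (J : Set (Fin 2)) (w : W) :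
    (cs.descentElement F J).coeff w = if w ∈ cs.minCosetReps J then 1 else 0 := by
  rw [descentElement, coeff_sum, Finsupp.finsetSum_apply]
  simp [Finsupp.single_apply]

theorem descentElement_univ : cs.descentElement F Set.univ = 1 := by
  classical
  ext w
  rw [coeff_descentElement, minCosetReps_univ, one_def, coeff_single, Finsupp.single_apply]
  exact if_congr (by simp [eq_comm]) rfl rfl

theorem descentElement_empty : cs.descentElement F ∅ = ∑ w : W, of F W w := by
  classical
  rw [descentElement, minCosetReps_empty]
  simp

theorem descentElement_singleton {i j : Fin 2} (hij : i ≠ j) {n : ℕ} (hn : 0 < n)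
    (hM : M i j = n) :
    cs.descentElement F {i} = ∑ k ∈ Finset.range n, of F W (cs.alt i j k) := by
  classical
  rw [descentElement, ← Finset.sum_image (s := Finset.range n) (g := cs.alt i j)
    (f := fun w => of F W w)]
  · refine Finset.sum_congr ?_ fun _ _ => rfl
    ext w
    simp only [Finset.mem_filter, Finset.mem_univ, true_and, Finset.mem_image, Finset.mem_range,
      cs.mem_minCosetReps_singleton hij hn hM, eq_comm]
  · intro k hk l hl h
    simp only [Finset.coe_range, Set.mem_Iio] at hk hl
    exact cs.alt_injective hij hM (by lia) (by lia) h

theorem descentElement_empty_eq_sum_alt {i j : Fin 2} (hij : i ≠ j) {n : ℕ} (hn : 0 < n)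
    (hM : M i j = n) :
    cs.descentElement F ∅ = ∑ k ∈ Finset.range (2 * n), of F W (cs.alt i j k) := by
  classical
  rw [descentElement_empty, ← Finset.sum_image (s := Finset.range (2 * n)) (g := cs.alt i j)
    (f := fun w => of F W w)]
  · refine Finset.sum_congr ?_ fun _ _ => rfl
    ext w
    obtain ⟨k, hk, rfl⟩ := cs.exists_lt_two_mul_eq_alt hij hn hM w
    simpa using ⟨k, hk, rfl⟩
  · intro k hk l hl h
    simp only [Finset.coe_range, Set.mem_Iio] at hk hl
    exact cs.alt_injective hij hM hk hl h

theorem descentElement_empty_mul_of (w : W) :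
    cs.descentElement F ∅ * of F W w = cs.descentElement F ∅ := by
  rw [descentElement_empty, Finset.sum_mul]
  simp only [← map_mul]
  exact Fintype.sum_equiv (Equiv.mulRight w) _ _ fun _ => rfl

theorem of_mul_descentElement_empty (w : W) :
    of F W w * cs.descentElement F ∅ = cs.descentElement F ∅ := by
  rw [descentElement_empty, Finset.mul_sum]
  simp only [← map_mul]
  exact Fintype.sum_equiv (Equiv.mulLeft w) _ _ fun _ => rfl

end DescentElements

end CoxeterSystem

/-! ### The multiplication table of the descent algebra -/

theorem Finset.sum_range_two_mul {R : Type*} [AddCommMonoid R] (f : ℕ → R) (h : ℕ) :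
    ∑ k ∈ Finset.range (2 * h), f k = ∑ l ∈ Finset.range h, (f (2 * l) + f (2 * l + 1)) := by
  induction h with
  | zero => simp
  | succ h ih => rw [Nat.mul_succ, Finset.sum_range_succ, Finset.sum_range_succ, ih,
      Finset.sum_range_succ, add_assoc]

theorem Finset.sum_range_two_mul_add_one {R : Type*} [AddCommMonoid R] (f : ℕ → R) (h : ℕ) :
    ∑ k ∈ Finset.range (2 * h + 1), f k =
      f 0 + ∑ l ∈ Finset.range h, (f (2 * l + 1) + f (2 * l + 2)) := by
  rw [Finset.sum_range_succ', Finset.sum_range_two_mul, add_comm]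

namespace CoxeterSystem

variable {M : CoxeterMatrix (Fin 2)} {W : Type v} [Group W] [Fintype W] (cs : CoxeterSystem M W)
  (F : Type u) [Field F]

open MonoidAlgebra

theorem descentElement_empty_eq_add {i j : Fin 2} (hij : i ≠ j) {n : ℕ} (hn : 0 < n)
    (hM : M i j = n) : cs.descentElement F ∅ = cs.descentElement F {i} +
      ∑ k ∈ Finset.range n, of F W (cs.alt i j (n + k)) := by
  rw [cs.descentElement_empty_eq_sum_alt F hij hn hM, cs.descentElement_singleton F hij hn hM,
    two_mul, Finset.sum_range_add]

/-- The coset representatives `X_i` together with their translates by the reflection `i` exhaust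
the group. -/
theorem descentElement_singleton_mul {i j : Fin 2} (hij : i ≠ j) {n : ℕ} (hn : 0 < n)
    (hM : M i j = n) :
    cs.descentElement F {i} * (1 + of F W (cs.simple i)) = cs.descentElement F ∅ := by
  rw [cs.descentElement_empty_eq_add F hij hn hM, mul_add, mul_one]
  congr 1
  rw [cs.descentElement_singleton F hij hn hM, Finset.sum_mul,
    ← Finset.sum_range_reflect (fun k => of F W (cs.alt i j (n + k)))]
  refine Finset.sum_congr rfl fun k hk => ?_
  have hk := Finset.mem_range.1 hk
  rw [← map_mul, ← alt_succ, cs.alt_eq_alt_sub ((M.symmetric j i).trans hM) (by lia)]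
  congr 2
  lia

theorem mul_sum_pairs {x : MonoidAlgebra F W} {s : W}
    (hx : x * (1 + of F W s) = cs.descentElement F ∅) (g : ℕ → W) (h : ℕ) :
    x * ∑ l ∈ Finset.range h, (of F W (g l) + of F W (s * g l)) =
      h • cs.descentElement F ∅ := by
  have key : ∀ l, x * (of F W (g l) + of F W (s * g l)) = cs.descentElement F ∅ := by
    intro l
    rw [map_mul, ← one_add_mul, ← mul_assoc, hx, descentElement_empty_mul_of]
  rw [Finset.mul_sum, Finset.sum_congr rfl fun l _ => key l, Finset.sum_const, Finset.card_range]

theorem descentElement_singleton_mul_empty {i j : Fin 2} (hij : i ≠ j) {n : ℕ} (hn : 0 < n)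
    (hM : M i j = n) :
    cs.descentElement F {i} * cs.descentElement F ∅ = n • cs.descentElement F ∅ := by
  rw [cs.descentElement_singleton F hij hn hM, Finset.sum_mul]
  simp only [of_mul_descentElement_empty, Finset.sum_const, Finset.card_range]

theorem descentElement_empty_mul_singleton {i j : Fin 2} (hij : i ≠ j) {n : ℕ} (hn : 0 < n)
    (hM : M i j = n) :
    cs.descentElement F ∅ * cs.descentElement F {i} = n • cs.descentElement F ∅ := by
  rw [cs.descentElement_singleton F hij hn hM, Finset.mul_sum]
  simp only [descentElement_empty_mul_of, Finset.sum_const, Finset.card_range]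

theorem descentElement_empty_mul_empty {i j : Fin 2} (hij : i ≠ j) {n : ℕ} (hn : 0 < n)
    (hM : M i j = n) :
    cs.descentElement F ∅ * cs.descentElement F ∅ = (2 * n) • cs.descentElement F ∅ := by
  nth_rw 2 [cs.descentElement_empty_eq_sum_alt F hij hn hM]
  rw [Finset.mul_sum]
  simp only [descentElement_empty_mul_of, Finset.sum_const, Finset.card_range]

theorem descentElement_singleton_sq_of_odd {i j : Fin 2} (hij : i ≠ j) {h : ℕ}
    (hM : M i j = 2 * h + 1) : cs.descentElement F {i} * cs.descentElement F {i} =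
      cs.descentElement F {i} + h • cs.descentElement F ∅ := by
  have hx := cs.descentElement_singleton_mul F hij (by lia) hM
  have ha := cs.descentElement_singleton F hij (by lia) hM
  nth_rw 2 [ha]
  rw [Finset.sum_range_two_mul_add_one, alt_zero, map_one, mul_add, mul_one]
  simp only [← simple_mul_alt_two_mul_add_one]
  rw [cs.mul_sum_pairs F hx]

theorem descentElement_singleton_mul_of_odd {i j : Fin 2} (hij : i ≠ j) {h : ℕ}
    (hM : M i j = 2 * h + 1) : cs.descentElement F {j} * cs.descentElement F {i} =
      cs.descentElement F {i} + h • cs.descentElement F ∅ := by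
  have hM' := (M.symmetric j i).trans hM
  have hx := cs.descentElement_singleton_mul F hij.symm (by lia) hM'
  have ha := cs.descentElement_singleton F hij (by lia) hM
  have hb := cs.descentElement_singleton F hij.symm (by lia) hM'
  -- the even alternating word of length `n - 1` carries `X_j` to `X_i`
  have hlast : cs.descentElement F {j} * of F W (cs.alt i j (2 * h)) = cs.descentElement F {i} := by
    rw [ha, hb, Finset.sum_mul, ← Finset.sum_range_reflect (fun k => of F W (cs.alt i j k))]
    refine Finset.sum_congr rfl fun k hk => ?_
    have hk := Finset.mem_range.1 hk
    rw [← map_mul, cs.alt_eq_alt_sub hM' (by lia), ← alt_add_two_mul]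
    have : 2 * (2 * h + 1) - k + 2 * h = (2 * h + 1 - 1 - k) + 2 * (2 * h + 1) := by lia
    rw [this, alt_add_two_mul, cs.alt_two_mul_self hM, mul_one]
  nth_rw 1 [ha]
  rw [Finset.sum_range_succ, Finset.sum_range_two_mul, mul_add, hlast]
  simp only [← simple_mul_alt_two_mul]
  rw [cs.mul_sum_pairs F hx, add_comm]

theorem descentElement_singleton_sq_of_even {i j : Fin 2} (hij : i ≠ j) {h : ℕ} (hh : 0 < h)
    (hM : M i j = 2 * h) :
    cs.descentElement F {i} * cs.descentElement F {i} + cs.descentElement F ∅ =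
      2 • cs.descentElement F {i} + h • cs.descentElement F ∅ := by
  have hx := cs.descentElement_singleton_mul F hij (by lia) hM
  have ha := cs.descentElement_singleton F hij (by lia) hM
  obtain ⟨h, rfl⟩ : ∃ h', h = h' + 1 := ⟨h - 1, by lia⟩
  -- multiplication by the alternating word of length `n - 1` permutes `X_i`
  have hlast : cs.descentElement F {i} * of F W (cs.alt i j (2 * h + 1)) =
      cs.descentElement F {i} := by
    have h1 : cs.alt i j (2 * h + 1) = cs.simple i * cs.alt i j (2 * (h + 1)) := by
      rw [Nat.mul_succ, ← simple_mul_alt_two_mul_add_one, simple_mul_simple_cancel_left]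
    have h2 : cs.descentElement F {i} * of F W (cs.simple i) =
        cs.descentElement F ∅ - cs.descentElement F {i} := by
      rw [← hx]; noncomm_ring
    have h3 : cs.descentElement F {i} * of F W (cs.alt i j (2 * (h + 1))) =
        cs.descentElement F ∅ - cs.descentElement F {i} := by
      rw [cs.descentElement_empty_eq_add F hij (by lia) hM, add_sub_cancel_left]
      nth_rw 1 [ha]
      rw [Finset.sum_mul]
      refine Finset.sum_congr rfl fun k _ => ?_
      rw [← map_mul, ← alt_add_two_mul, add_comm]
    rw [h1, map_mul, ← mul_assoc, h2, sub_mul, h3, descentElement_empty_mul_of, sub_sub_cancel]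
  nth_rw 2 [ha]
  rw [Nat.mul_succ, Finset.sum_range_succ, Finset.sum_range_two_mul_add_one, alt_zero, map_one,
    mul_add, mul_add, mul_one, hlast]
  simp only [← simple_mul_alt_two_mul_add_one]
  rw [cs.mul_sum_pairs F hx, succ_nsmul _ h, two_nsmul]
  abel

theorem descentElement_singleton_mul_of_even {i j : Fin 2} (hij : i ≠ j) {h : ℕ} (hh : 0 < h)
    (hM : M i j = 2 * h) : cs.descentElement F {j} * cs.descentElement F {i} =
      h • cs.descentElement F ∅ := by
  have hM' := (M.symmetric j i).trans hM
  have hx := cs.descentElement_singleton_mul F hij.symm (by lia) hM'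
  rw [cs.descentElement_singleton F hij (by lia) hM, Finset.sum_range_two_mul]
  simp only [← simple_mul_alt_two_mul]
  rw [cs.mul_sum_pairs F hx]

end CoxeterSystem

/-! ### Representation type read off from the multiplication table -/

section Table

variable {F : Type u} [Field F] {A : Type v} [Ring A] [Algebra F A] {a b z : A}

theorem Algebra.adjoin_eq_top_of_subset {s t : Set A} (hs : Algebra.adjoin F s = ⊤)
    (hst : s ⊆ Algebra.adjoin F t) : Algebra.adjoin F t = ⊤ :=
  top_le_iff.1 (hs ▸ Algebra.adjoin_le hst)

theorem Algebra.toSubmodule_adjoin_eq_span {s : Set A} (h1 : 1 ∈ Submodule.span F s)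
    (hmul : ∀ x ∈ s, ∀ y ∈ s, x * y ∈ Submodule.span F s) :
    Subalgebra.toSubmodule (Algebra.adjoin F s) = Submodule.span F s := by
  have h2 : Submodule.span F s * Submodule.span F s ≤ Submodule.span F s := by
    rw [Submodule.span_mul_span, Submodule.span_le]
    rintro _ ⟨x, hx, y, hy, rfl⟩
    exact hmul x hx y hy
  refine le_antisymm ?_ (Algebra.span_le_adjoin F s)
  have h3 : Algebra.adjoin F s ≤ (Submodule.span F s).toSubalgebra h1
      fun x y hx hy => h2 (Submodule.mul_mem_mul hx hy) :=
    Algebra.adjoin_le Submodule.subset_span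
  exact h3

/-- If `2` is invertible, the table of the dihedral group of order `4 h` splits off two orthogonal
idempotents. -/
theorem hasFiniteRepType_of_even_table {h : F} (h2 : (2 : F) ≠ 0)
    (hgen : Algebra.adjoin F {a, b, z} = ⊤) (haa : a * a = (2 : F) • a + (h - 1) • z)
    (hbb : b * b = (2 : F) • b + (h - 1) • z) (hab : a * b = h • z) (hba : b * a = h • z)
    (haz : a * z = (2 * h) • z) (hza : z * a = (2 * h) • z) (hbz : b * z = (2 * h) • z)
    (hzb : z * b = (2 * h) • z) (hzz : z * z = (4 * h) • z) : HasFiniteRepType F A := by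
  refine hasFiniteRepType_of_orthogonal_idempotents (e := (2⁻¹ : F) • a - (2⁻¹ * 2⁻¹ : F) • z)
    (f := (2⁻¹ : F) • b - (2⁻¹ * 2⁻¹ : F) • z) (z := z) (c := 4 * h) ?_ ?_ ?_ ?_ ?_ ?_ ?_ ?_ ?_ hzz
  · refine Algebra.adjoin_eq_top_of_subset hgen ?_
    set S := Algebra.adjoin F
      {(2⁻¹ : F) • a - (2⁻¹ * 2⁻¹ : F) • z, (2⁻¹ : F) • b - (2⁻¹ * 2⁻¹ : F) • z, z}
    have hz : z ∈ S := Algebra.subset_adjoin (by simp)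
    have key : ∀ x, (2⁻¹ : F) • x - (2⁻¹ * 2⁻¹ : F) • z ∈ S → x ∈ S := by
      intro x hx
      have h1 : x = (2 : F) • ((2⁻¹ : F) • x - (2⁻¹ * 2⁻¹ : F) • z) + (2⁻¹ : F) • z := by
        match_scalars <;> field_simp <;> ring
      rw [h1]
      exact add_mem (S.smul_mem hx _) (S.smul_mem hz _)
    rintro x (rfl | rfl | rfl)
    · exact key _ (Algebra.subset_adjoin (by simp))
    · exact key _ (Algebra.subset_adjoin (by simp))
    · exact hz
  all_goals
    simp only [mul_sub, sub_mul, smul_mul_assoc, mul_smul_comm, haa, hbb, hab, hba, haz, hza, hbz,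
      hzb, hzz]
    match_scalars <;> field_simp <;> ring

/-- If `2` is invertible, the table of the dihedral group of order `2 (2 h + 1)` is that of
an arrow `b - a` from the kernel to the image of the idempotent `a - z / 2`, with the loop `z` at
the source of the arrow. -/
theorem hasFiniteRepType_of_odd_table {h : F} (h2 : (2 : F) ≠ 0)
    (hgen : Algebra.adjoin F {a, b, z} = ⊤) (haa : a * a = a + h • z)
    (hab : a * b = b + h • z) (hba : b * a = a + h • z) (haz : a * z = (2 * h + 1) • z)
    (hza : z * a = (2 * h + 1) • z) (hbz : b * z = (2 * h + 1) • z)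
    (hzb : z * b = (2 * h + 1) • z) (hzz : z * z = (2 * (2 * h + 1)) • z) :
    HasFiniteRepType F A := by
  refine hasFiniteRepType_of_loop_at_source (e := a - (2⁻¹ : F) • z) (y := b - a) (z := z)
    (c := 2 * (2 * h + 1)) ?_ ?_ ?_ ?_ ?_ ?_ ?_ hzz
  · refine Algebra.adjoin_eq_top_of_subset hgen ?_
    set S := Algebra.adjoin F {a - (2⁻¹ : F) • z, b - a, z}
    have hz : z ∈ S := Algebra.subset_adjoin (by simp)
    have ha : a ∈ S := by
      have h1 : a - (2⁻¹ : F) • z ∈ S := Algebra.subset_adjoin (by simp)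
      simpa using add_mem h1 (S.smul_mem hz (2⁻¹ : F))
    have hb : b ∈ S := by
      have h1 : b - a ∈ S := Algebra.subset_adjoin (by simp)
      simpa using add_mem h1 ha
    rintro x (rfl | rfl | rfl) <;> assumption
  all_goals
    simp only [mul_sub, sub_mul, smul_mul_assoc, mul_smul_comm, haa, hab, hba, haz, hza, hbz,
      hzb, hzz]
    match_scalars <;> field_simp <;> ring

/-- If `2 = 0`, the element `a - z / 2` is not available, but `a + h z` is idempotent because
`z² = 0`; it fixes `z`, so that `z` is now a loop at the target of the arrow `b - a`. -/
theorem hasFiniteRepType_of_odd_table_of_two_eq_zero {h : F} (h2 : (2 : F) = 0)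
    (hgen : Algebra.adjoin F {a, b, z} = ⊤) (haa : a * a = a + h • z)
    (hab : a * b = b + h • z) (hba : b * a = a + h • z) (haz : a * z = (2 * h + 1) • z)
    (hza : z * a = (2 * h + 1) • z) (hbz : b * z = (2 * h + 1) • z)
    (hzb : z * b = (2 * h + 1) • z) (hzz : z * z = (2 * (2 * h + 1)) • z) :
    HasFiniteRepType F A := by
  simp only [h2, zero_mul, zero_add, one_smul, zero_smul] at haz hza hbz hzb hzz
  refine hasFiniteRepType_of_loop_at_target (e := a + h • z) (y := b - a) (z := z)
    ?_ ?_ ?_ ?_ ?_ ?_ ?_ hzz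
  · refine Algebra.adjoin_eq_top_of_subset hgen ?_
    set S := Algebra.adjoin F {a + h • z, b - a, z}
    have hz : z ∈ S := Algebra.subset_adjoin (by simp)
    have ha : a ∈ S := by
      have h1 : a + h • z ∈ S := Algebra.subset_adjoin (by simp)
      simpa using sub_mem h1 (S.smul_mem hz h)
    have hb : b ∈ S := by
      have h1 : b - a ∈ S := Algebra.subset_adjoin (by simp)
      simpa using add_mem h1 ha
    rintro x (rfl | rfl | rfl) <;> assumption
  all_goals
    simp only [mul_sub, sub_mul, mul_add, add_mul, smul_mul_assoc, mul_smul_comm, haa, hab,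
      hba, haz, hza, hbz, hzb, hzz]
    match_scalars <;> first | ring1 | linear_combination h * h2

end Table

/-! ### The descent algebra of a dihedral group -/

namespace CoxeterSystem

section DihedralDescentAlgebra

variable {M : CoxeterMatrix (Fin 2)} {W : Type v} [Group W] [Fintype W] (cs : CoxeterSystem M W)
  (F : Type u) [Field F]

theorem eq_empty_or_singleton_or_univ (J : Set (Fin 2)) :
    J = ∅ ∨ (∃ i, J = {i}) ∨ J = Set.univ := by
  by_cases h0 : 0 ∈ J <;> by_cases h1 : 1 ∈ J
  · refine Or.inr (Or.inr (Set.eq_univ_of_forall fun i => ?_))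
    fin_cases i <;> assumption
  · refine Or.inr (Or.inl ⟨0, ?_⟩)
    ext i
    fin_cases i <;> simpa
  · refine Or.inr (Or.inl ⟨1, ?_⟩)
    ext i
    fin_cases i <;> simpa
  · refine Or.inl (Set.eq_empty_of_forall_notMem fun i => ?_)
    fin_cases i <;> assumption

theorem range_descentElement : Set.range (cs.descentElement F) =
    Set.range ![1, cs.descentElement F {0}, cs.descentElement F {1}, cs.descentElement F ∅] := by
  simp only [Matrix.range_cons, Matrix.range_empty, Set.union_empty]
  ext x
  constructor
  · rintro ⟨J, rfl⟩
    rcases eq_empty_or_singleton_or_univ J with rfl | ⟨i, rfl⟩ | rfl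
    · simp
    · fin_cases i <;> simp
    · simp [descentElement_univ]
  · rintro (rfl | rfl | rfl | rfl)
    · exact ⟨_, cs.descentElement_univ F⟩
    all_goals exact Set.mem_range_self _

/-- The coefficients at the longest element, at the two reflections and at `1` separate the four
elements. -/
theorem linearIndependent_descentElement {n : ℕ} (hn : 1 < n) (hM : M 0 1 = n) :
    LinearIndependent F
      ![1, cs.descentElement F {0}, cs.descentElement F {1}, cs.descentElement F ∅] := by
  classical
  have hM' : M 1 0 = n := (M.symmetric 1 0).trans hM
  have h01 : (0 : Fin 2) ≠ 1 := by simp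
  rw [Fintype.linearIndependent_iff]
  intro g hg
  simp only [Fin.sum_univ_four, Matrix.cons_val, ← cs.descentElement_univ F] at hg
  have hcoeff : ∀ w : W, (if w = 1 then g 0 else 0) +
      (if w ∈ cs.minCosetReps {0} then g 1 else 0) +
      (if w ∈ cs.minCosetReps {1} then g 2 else 0) + g 3 = 0 := by
    intro w
    have := congrArg (fun x => x.coeff w) hg
    simpa [coeff_descentElement, minCosetReps_univ, minCosetReps_empty] using this
  have hs : ∀ i j : Fin 2, i ≠ j → M i j = n →
      cs.simple j ∈ cs.minCosetReps {i} ∧ cs.simple j ∉ cs.minCosetReps {j} ∧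
        cs.simple j ≠ 1 := by
    intro i j hij h
    refine ⟨(cs.mem_minCosetReps_singleton hij (by lia) h _).2 ⟨1, hn, (cs.alt_one i j).symm⟩,
      by simp [minCosetReps], fun h1 => ?_⟩
    simpa [h1] using cs.length_simple j
  have hlong : ∀ i j : Fin 2, i ≠ j → M i j = n → cs.alt i j n ∉ cs.minCosetReps {i} := by
    intro i j hij h hmem
    obtain ⟨k, hk, hk'⟩ := (cs.mem_minCosetReps_singleton hij (by lia) h _).1 hmem
    have := cs.alt_injective hij h (by lia) (by lia) hk'
    lia
  have hsymm : cs.alt 0 1 n = cs.alt 1 0 n := by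
    rw [cs.alt_eq_alt_sub hM (by lia), two_mul, Nat.add_sub_cancel]
  have h3 : g 3 = 0 := by
    have hne : cs.alt 0 1 n ≠ 1 := by
      rw [Ne, ← cs.length_eq_zero_iff, cs.length_alt h01 (by lia) hM le_rfl]
      lia
    have := hcoeff (cs.alt 0 1 n)
    rwa [if_neg hne, if_neg (hlong 0 1 h01 hM),
      if_neg (hsymm ▸ hlong 1 0 h01.symm hM'), zero_add, zero_add, zero_add] at this
  have h1 : g 1 = 0 := by
    have := hcoeff (cs.simple 1)
    obtain ⟨ha, hb, hc⟩ := hs 0 1 h01 hM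
    simpa [ha, hb, hc, h3] using this
  have h2 : g 2 = 0 := by
    have := hcoeff (cs.simple 0)
    obtain ⟨ha, hb, hc⟩ := hs 1 0 h01.symm hM'
    simpa [ha, hb, hc, h3] using this
  have h0 : g 0 = 0 := by simpa [h1, h2, h3] using hcoeff 1
  intro i
  fin_cases i <;> assumption

theorem descentElement_mul_mem_span {n : ℕ} (hn : 1 < n) (hM : M 0 1 = n) (J K : Set (Fin 2)) :
    cs.descentElement F J * cs.descentElement F K ∈
      Submodule.span F (Set.range (cs.descentElement F)) := by
  have hmem : ∀ J, cs.descentElement F J ∈ Submodule.span F (Set.range (cs.descentElement F)) :=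
    fun J => Submodule.subset_span (Set.mem_range_self J)
  have hM' : ∀ i j, i ≠ j → M i j = n := by
    intro i j hij
    fin_cases i <;> fin_cases j <;>
      first | exact absurd rfl hij | exact hM | exact (M.symmetric 1 0).trans hM
  have hmul : ∀ i j, i ≠ j → cs.descentElement F {i} * cs.descentElement F {i} ∈
      Submodule.span F (Set.range (cs.descentElement F)) ∧
      cs.descentElement F {j} * cs.descentElement F {i} ∈
        Submodule.span F (Set.range (cs.descentElement F)) := by
    intro i j hij
    rcases n.even_or_odd' with ⟨h, rfl | rfl⟩
    · rw [eq_sub_of_add_eq (cs.descentElement_singleton_sq_of_even F hij (by lia) (hM' i j hij)),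
        cs.descentElement_singleton_mul_of_even F hij (by lia) (hM' i j hij)]
      exact ⟨sub_mem (add_mem (nsmul_mem (hmem _) _) (nsmul_mem (hmem _) _)) (hmem _),
        nsmul_mem (hmem _) _⟩
    · rw [cs.descentElement_singleton_sq_of_odd F hij (hM' i j hij),
        cs.descentElement_singleton_mul_of_odd F hij (hM' i j hij)]
      exact ⟨add_mem (hmem _) (nsmul_mem (hmem _) _), add_mem (hmem _) (nsmul_mem (hmem _) _)⟩
  have hne : ∀ i : Fin 2, ∃ j, i ≠ j := fun i => ⟨1 - i, by fin_cases i <;> simp⟩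
  rcases eq_empty_or_singleton_or_univ J with rfl | ⟨i, rfl⟩ | rfl
  · rcases eq_empty_or_singleton_or_univ K with rfl | ⟨k, rfl⟩ | rfl
    · rw [cs.descentElement_empty_mul_empty F Fin.zero_ne_one (by lia) hM]
      exact nsmul_mem (hmem _) _
    · obtain ⟨l, hl⟩ := hne k
      rw [cs.descentElement_empty_mul_singleton F hl (by lia) (hM' k l hl)]
      exact nsmul_mem (hmem _) _
    · rw [descentElement_univ, mul_one]
      exact hmem _
  · rcases eq_empty_or_singleton_or_univ K with rfl | ⟨k, rfl⟩ | rfl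
    · obtain ⟨l, hl⟩ := hne i
      rw [cs.descentElement_singleton_mul_empty F hl (by lia) (hM' i l hl)]
      exact nsmul_mem (hmem _) _
    · by_cases hik : k = i
      · obtain ⟨l, hl⟩ := hne i
        rw [hik]
        exact (hmul i l hl).1
      · exact (hmul k i hik).2
    · rw [descentElement_univ, mul_one]
      exact hmem _
  · rw [descentElement_univ, one_mul]
    exact hmem _

theorem toSubmodule_descentAlgebra {n : ℕ} (hn : 1 < n) (hM : M 0 1 = n) :
    Subalgebra.toSubmodule (cs.descentAlgebra F) =
      Submodule.span F (Set.range (cs.descentElement F)) := by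
  refine Algebra.toSubmodule_adjoin_eq_span ?_ ?_
  · rw [← cs.descentElement_univ F]
    exact Submodule.subset_span (Set.mem_range_self _)
  · rintro _ ⟨J, rfl⟩ _ ⟨K, rfl⟩
    exact cs.descentElement_mul_mem_span F hn hM J K

theorem finrank_descentAlgebra {n : ℕ} (hn : 1 < n) (hM : M 0 1 = n) :
    Module.finrank F (cs.descentAlgebra F) = 4 := by
  rw [← Subalgebra.finrank_toSubmodule, cs.toSubmodule_descentAlgebra F hn hM,
    range_descentElement, finrank_span_eq_card (cs.linearIndependent_descentElement F hn hM),
    Fintype.card_fin]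

/-- The element `x_J` as an element of the descent algebra. -/
noncomputable def descentGenerator (J : Set (Fin 2)) : cs.descentAlgebra F :=
  ⟨cs.descentElement F J, Algebra.subset_adjoin (Set.mem_range_self J)⟩

theorem adjoin_descentGenerator :
    Algebra.adjoin F {cs.descentGenerator F {0}, cs.descentGenerator F {1},
      cs.descentGenerator F ∅} = ⊤ := by
  refine Algebra.adjoin_eq_top_of_subset
    (Algebra.adjoin_adjoin_coe_preimage (s := Set.range (cs.descentElement F))) ?_
  rintro x ⟨J, hJ⟩
  have hx : x = cs.descentGenerator F J := Subtype.ext hJ.symm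
  rcases eq_empty_or_singleton_or_univ J with rfl | ⟨i, rfl⟩ | rfl
  · exact Algebra.subset_adjoin (by simp [hx])
  · refine Algebra.subset_adjoin ?_
    fin_cases i <;> simp [hx]
  · have h1 : x = 1 := hx.trans (Subtype.ext (cs.descentElement_univ F))
    rw [h1]
    exact one_mem _

theorem linearIndependent_descentGenerator {n : ℕ} (hn : 1 < n) (hM : M 0 1 = n) :
    LinearIndependent F ![1, cs.descentGenerator F {0}, cs.descentGenerator F {1},
      cs.descentGenerator F ∅] := by
  refine LinearIndependent.of_comp (cs.descentAlgebra F).val.toLinearMap ?_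
  have h : (cs.descentAlgebra F).val ∘ ![1, cs.descentGenerator F {0}, cs.descentGenerator F {1},
      cs.descentGenerator F ∅] =
      ![1, cs.descentElement F {0}, cs.descentElement F {1}, cs.descentElement F ∅] := by
    funext i
    fin_cases i <;> rfl
  have hli := cs.linearIndependent_descentElement F hn hM
  rw [← h] at hli
  exact hli

theorem descentGenerator_singleton_mul_empty {i j : Fin 2} (hij : i ≠ j) {n : ℕ} (hn : 0 < n)
    (hM : M i j = n) : cs.descentGenerator F {i} * cs.descentGenerator F ∅ =
      (n : F) • cs.descentGenerator F ∅ := by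
  rw [Nat.cast_smul_eq_nsmul]
  exact Subtype.ext (cs.descentElement_singleton_mul_empty F hij hn hM)

theorem descentGenerator_empty_mul_singleton {i j : Fin 2} (hij : i ≠ j) {n : ℕ} (hn : 0 < n)
    (hM : M i j = n) : cs.descentGenerator F ∅ * cs.descentGenerator F {i} =
      (n : F) • cs.descentGenerator F ∅ := by
  rw [Nat.cast_smul_eq_nsmul]
  exact Subtype.ext (cs.descentElement_empty_mul_singleton F hij hn hM)

theorem descentGenerator_empty_mul_empty {i j : Fin 2} (hij : i ≠ j) {n : ℕ} (hn : 0 < n)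
    (hM : M i j = n) : cs.descentGenerator F ∅ * cs.descentGenerator F ∅ =
      (2 * n : F) • cs.descentGenerator F ∅ := by
  have h : (2 * n : F) = (2 * n : ℕ) := by push_cast; rfl
  rw [h, Nat.cast_smul_eq_nsmul]
  exact Subtype.ext (cs.descentElement_empty_mul_empty F hij hn hM)

theorem descentGenerator_singleton_sq_of_odd {i j : Fin 2} (hij : i ≠ j) {h : ℕ}
    (hM : M i j = 2 * h + 1) : cs.descentGenerator F {i} * cs.descentGenerator F {i} =
      cs.descentGenerator F {i} + (h : F) • cs.descentGenerator F ∅ := by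
  rw [Nat.cast_smul_eq_nsmul]
  exact Subtype.ext (cs.descentElement_singleton_sq_of_odd F hij hM)

theorem descentGenerator_singleton_mul_of_odd {i j : Fin 2} (hij : i ≠ j) {h : ℕ}
    (hM : M i j = 2 * h + 1) : cs.descentGenerator F {j} * cs.descentGenerator F {i} =
      cs.descentGenerator F {i} + (h : F) • cs.descentGenerator F ∅ := by
  rw [Nat.cast_smul_eq_nsmul]
  exact Subtype.ext (cs.descentElement_singleton_mul_of_odd F hij hM)

theorem descentGenerator_singleton_sq_of_even {i j : Fin 2} (hij : i ≠ j) {h : ℕ} (hh : 0 < h)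
    (hM : M i j = 2 * h) : cs.descentGenerator F {i} * cs.descentGenerator F {i} =
      (2 : F) • cs.descentGenerator F {i} + ((h : F) - 1) • cs.descentGenerator F ∅ := by
  rw [sub_smul, one_smul, Nat.cast_smul_eq_nsmul, ofNat_smul_eq_nsmul, ← add_sub_assoc]
  exact eq_sub_of_add_eq (Subtype.ext (cs.descentElement_singleton_sq_of_even F hij hh hM))

theorem descentGenerator_singleton_mul_of_even {i j : Fin 2} (hij : i ≠ j) {h : ℕ} (hh : 0 < h)
    (hM : M i j = 2 * h) : cs.descentGenerator F {j} * cs.descentGenerator F {i} =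
      (h : F) • cs.descentGenerator F ∅ := by
  rw [Nat.cast_smul_eq_nsmul]
  exact Subtype.ext (cs.descentElement_singleton_mul_of_even F hij hh hM)

theorem hasFiniteRepType_descentAlgebra_of_even {h : ℕ} (hh : 0 < h) (hM : M 0 1 = 2 * h)
    (h2 : (2 : F) ≠ 0) : HasFiniteRepType F (cs.descentAlgebra F) := by
  have hM' : M 1 0 = 2 * h := (M.symmetric 1 0).trans hM
  have h01 : (0 : Fin 2) ≠ 1 := by simp
  have hcast : ((2 * h : ℕ) : F) = 2 * h := by push_cast; rfl
  refine hasFiniteRepType_of_even_table (h := (h : F)) h2 (cs.adjoin_descentGenerator F)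
    (cs.descentGenerator_singleton_sq_of_even F h01 hh hM)
    (cs.descentGenerator_singleton_sq_of_even F h01.symm hh hM')
    (cs.descentGenerator_singleton_mul_of_even F h01.symm hh hM')
    (cs.descentGenerator_singleton_mul_of_even F h01 hh hM) ?_ ?_ ?_ ?_ ?_
  · rw [cs.descentGenerator_singleton_mul_empty F h01 (by lia) hM, hcast]
  · rw [cs.descentGenerator_empty_mul_singleton F h01 (by lia) hM, hcast]
  · rw [cs.descentGenerator_singleton_mul_empty F h01.symm (by lia) hM', hcast]
  · rw [cs.descentGenerator_empty_mul_singleton F h01.symm (by lia) hM', hcast]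
  · rw [cs.descentGenerator_empty_mul_empty F h01 (by lia) hM, hcast]
    congr 1
    ring

theorem hasFiniteRepType_descentAlgebra_of_odd {h : ℕ} (hM : M 0 1 = 2 * h + 1) :
    HasFiniteRepType F (cs.descentAlgebra F) := by
  have hM' : M 1 0 = 2 * h + 1 := (M.symmetric 1 0).trans hM
  have h01 : (0 : Fin 2) ≠ 1 := by simp
  have hcast : ((2 * h + 1 : ℕ) : F) = 2 * h + 1 := by push_cast; rfl
  have hgen := cs.adjoin_descentGenerator F
  have haa := cs.descentGenerator_singleton_sq_of_odd F h01 hM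
  have hab := cs.descentGenerator_singleton_mul_of_odd F h01.symm hM'
  have hba := cs.descentGenerator_singleton_mul_of_odd F h01 hM
  have haz := cs.descentGenerator_singleton_mul_empty F h01 (by lia) hM
  have hza := cs.descentGenerator_empty_mul_singleton F h01 (by lia) hM
  have hbz := cs.descentGenerator_singleton_mul_empty F h01.symm (by lia) hM'
  have hzb := cs.descentGenerator_empty_mul_singleton F h01.symm (by lia) hM'
  have hzz := cs.descentGenerator_empty_mul_empty F h01 (by lia) hM
  rw [hcast] at haz hza hbz hzb hzz
  by_cases h2 : (2 : F) = 0
  · exact hasFiniteRepType_of_odd_table_of_two_eq_zero h2 hgen haa hab hba haz hza hbz hzb hzz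
  · exact hasFiniteRepType_of_odd_table h2 hgen haa hab hba haz hza hbz hzb hzz

/-- In characteristic two, a dihedral group of order `4 h` has a local symmetric descent algebra;
the determinant `(h - 1)² - h²` of its form is odd. -/
theorem isLocalSymmetric_descentGenerator {h : ℕ} (hh : 0 < h) (hM : M 0 1 = 2 * h)
    (h2 : (2 : F) = 0) : IsLocalSymmetric (cs.descentGenerator F {0}) (cs.descentGenerator F {1})
      (cs.descentGenerator F ∅) ((h : F) - 1) (h : F) := by
  have hM' : M 1 0 = 2 * h := (M.symmetric 1 0).trans hM
  have h01 : (0 : Fin 2) ≠ 1 := by simp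
  have hcast : ((2 * h : ℕ) : F) = 0 := by push_cast; rw [h2, zero_mul]
  have hli := cs.linearIndependent_descentGenerator F (by lia) hM
  refine
    { linearIndependent := hli
      span_eq_top := ?_
      xx := ?_
      xy := cs.descentGenerator_singleton_mul_of_even F h01.symm hh hM'
      yx := cs.descentGenerator_singleton_mul_of_even F h01 hh hM
      yy := ?_
      xz := ?_
      zx := ?_
      yz := ?_
      zy := ?_
      zz := ?_
      nondegenerate := ?_ }
  · refine (hli.span_eq_top_of_card_eq_finrank ?_).ge
    rw [cs.finrank_descentAlgebra F (by lia) hM, Fintype.card_fin]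
  · rw [cs.descentGenerator_singleton_sq_of_even F h01 hh hM, h2, zero_smul, zero_add]
  · rw [cs.descentGenerator_singleton_sq_of_even F h01.symm hh hM', h2, zero_smul, zero_add]
  · rw [cs.descentGenerator_singleton_mul_empty F h01 (by lia) hM, hcast, zero_smul]
  · rw [cs.descentGenerator_empty_mul_singleton F h01 (by lia) hM, hcast, zero_smul]
  · rw [cs.descentGenerator_singleton_mul_empty F h01.symm (by lia) hM', hcast, zero_smul]
  · rw [cs.descentGenerator_empty_mul_singleton F h01.symm (by lia) hM', hcast, zero_smul]
  · rw [cs.descentGenerator_empty_mul_empty F h01 (by lia) hM, h2, zero_mul, zero_smul]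
  · have : ((h : F) - 1) * (h - 1) - h * h = 1 := by linear_combination (-h : F) * h2
    rw [this]
    exact one_ne_zero

end DihedralDescentAlgebra

end CoxeterSystem

theorem theorem7p3 {F : Type u} [Field F] [IsAlgClosed F] {n : ℕ} (hn : 4 ≤ n)
    {M : CoxeterMatrix (Fin 2)} (hM : M 0 1 = n)
    {W : Type v} [Group W] [Fintype W] (cs : CoxeterSystem M W) :
    Subalgebra.toSubmodule (cs.descentAlgebra F) =
        Submodule.span F (Set.range (cs.descentElement F)) ∧
    Module.finrank F (cs.descentAlgebra F) = 4 ∧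
    (CharP F 2 ∧ Even n → HasTameRepType F (cs.descentAlgebra F)) ∧
    (¬ (CharP F 2 ∧ Even n) → HasFiniteRepType F (cs.descentAlgebra F)) := by
  refine ⟨cs.toSubmodule_descentAlgebra F (by lia) hM, cs.finrank_descentAlgebra F (by lia) hM,
    ?_, ?_⟩
  · rintro ⟨hchar, heven⟩
    obtain ⟨h, rfl⟩ := heven.two_dvd
    exact (cs.isLocalSymmetric_descentGenerator F (by lia) hM
      (CharTwo.two_eq_zero)).hasTameRepType
  · intro hneg
    rcases n.even_or_odd' with ⟨h, rfl | rfl⟩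
    · exact cs.hasFiniteRepType_descentAlgebra_of_even F (by lia) hM fun h2 =>
        hneg ⟨CharTwo.of_one_ne_zero_of_two_eq_zero one_ne_zero h2, even_two_mul h⟩
    · exact cs.hasFiniteRepType_descentAlgebra_of_odd F hM
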